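/- Let $T\in\{1,2\}$ and let $0<p<1$ be fixed, $q=1-p$. A coin showing heads with probability $p$ and tails with probability $q$ is tossed $N$ times independently. A $T$-contaminated run of heads is a block of consecutive tosses containing precisely $T$ tails, all its other tosses being heads; let $\mu(N)$ be the length of the longest $T$-contaminated run of heads among the $N$ tosses (with $\mu(N)=0$ if there is none). Let $\log$ denote the logarithm of base $1/p$, $\ln$ the natural logarithm, $c=\ln(1/p)$ and $q_0=\frac{2q}{2+Tq-q}$, and put $$ \begin{aligned} m(N)={}&\log(qN)+T\log(\log(qN))+T^2\frac{\log(\log(qN))}{c\log(qN)}-\frac{T}{c\,q_0\log(qN)}-\frac{T^3}{2c}\left(\frac{\log(\log(qN))}{\log(qN)}\right)^2\\ &+T^2\frac{\log(\log(qN))}{c\,q_0(\log(qN))^2}+T^3\frac{\log(\log(qN))}{(c\log(qN))^2}\\ &+\left(T\log\left(\frac qp\right)-\log(T!)\right)\left(1+\frac{T}{c\log(qN)}-T^2\frac{\log(\log(qN))}{c(\log(qN))^2}\right). \end{aligned} $$ Let $[m(N)]$ be the integer part of $m(N)$ and $\{m(N)\}=m(N)-[m(N)]$ its fractional part. Then for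 every fixed integer $k$, as $N\to\infty$, $$ P\bigl(\mu(N)-[m(N)]<k\bigr)=\exp\left(-p^{\,(k-\{m(N)\})\left(1-\frac{T}{c\log(qN)}+T^2\frac{\log(\log(qN))}{c(\log(qN))^2}\right)}\right)\left(1+O\left(\frac1{(\log N)^2}\right)\right), $$ where the constant in $O(\cdot)$ may depend on $T$, $p$ and $k$. -/

import Mathlib

open MeasureTheory ProbabilityTheory Filter Asymptotics

/-- For a sequence `x` of `N` tosses (`true` is a head, `false` is a tail), the block of `m`
consecutive tosses starting at position `n` (positions are counted from `0`) lies inside the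
sequence and contains precisely `T` tails, all its other tosses being heads. -/
def IsContaminatedRun (T : ℕ) {N : ℕ} (x : Fin N → Bool) (n m : ℕ) : Prop :=
  n + m ≤ N ∧
    (Finset.univ.filter (fun i : Fin N => n ≤ (i : ℕ) ∧ (i : ℕ) < n + m ∧ x i = false)).card = T

/-- The lengths of the contaminated runs are at most `N`, so their supremum is a maximum. -/
theorem bddAbove_contaminatedRun (T : ℕ) {N : ℕ} (x : Fin N → Bool) :
    BddAbove {m : ℕ | ∃ n : ℕ, IsContaminatedRun T x n m} := by
  refine ⟨N, ?_⟩
  rintro m ⟨n, h, -⟩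
  omega

/-- The length of the longest `T`-contaminated run of heads in the tosses `x`
(it is `0` if there is no such run). -/
noncomputable def longestRun (T : ℕ) {N : ℕ} (x : Fin N → Bool) : ℕ :=
  sSup {m : ℕ | ∃ n : ℕ, IsContaminatedRun T x n m}

/-- The random variables `X i` are the results of independent tosses of a coin which
shows heads with probability `p`. -/
structure IsCoinTossing {Ω : Type*} [MeasurableSpace Ω] (P : Measure Ω) (p : ℝ) {N : ℕ}
    (X : Fin N → Ω → Bool) : Prop where
  measurable : ∀ i, Measurable (X i)
  indep : iIndepFun X P
  prob_heads : ∀ i, P.real {ω | X i ω = true} = p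
  prob_tails : ∀ i, P.real {ω | X i ω = false} = 1 - p

/-- `log (q N)` with `q = 1 - p`, where `log` is the logarithm of base `1 / p`. -/
noncomputable def logqN (p : ℝ) (N : ℕ) : ℝ := Real.logb (1 / p) ((1 - p) * N)

/-- `log (log (q N))`, both logarithms being of base `1 / p`. -/
noncomputable def loglogqN (p : ℝ) (N : ℕ) : ℝ := Real.logb (1 / p) (logqN p N)

/-- The constant `q₀ = 2 q / (2 + T q - q)`, `q = 1 - p`. -/
noncomputable def qZero (T : ℕ) (p : ℝ) : ℝ := 2 * (1 - p) / (2 + T * (1 - p) - (1 - p))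

/-- The centering `m(N)`; here `c = ln (1 / p)`, `l = log (q N)`, `ll = log (log (q N))`. -/
noncomputable def centering (T : ℕ) (p : ℝ) (N : ℕ) : ℝ :=
  let c : ℝ := Real.log (1 / p)
  let q : ℝ := 1 - p
  let q₀ : ℝ := qZero T p
  let l : ℝ := logqN p N
  let ll : ℝ := loglogqN p N
  l + T * ll
    + T ^ 2 * (ll / (c * l)) - T / (c * q₀ * l) - T ^ 3 / (2 * c) * (ll / l) ^ 2
    + T ^ 2 * (ll / (c * q₀ * l ^ 2)) + T ^ 3 * (ll / (c * l) ^ 2)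
    + (T * Real.logb (1 / p) (q / p) - Real.logb (1 / p) (T.factorial : ℝ))
      * (1 + T / (c * l) - T ^ 2 * (ll / (c * l ^ 2)))

/-- The factor `1 - T / (c log (q N)) + T² log (log (q N)) / (c (log (q N))²)`
with `c = ln (1 / p)`. -/
noncomputable def exponentFactor (T : ℕ) (p : ℝ) (N : ℕ) : ℝ :=
  let c : ℝ := Real.log (1 / p)
  1 - T / (c * logqN p N) + T ^ 2 * (loglogqN p N / (c * logqN p N ^ 2))

/-! Put m = [m(N)] + k and call a window of m consecutive tosses bad if it has at most T tails. A
bad window can be enlarged to one with exactly T tails unless the whole sequence has fewer than T,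
so up to a negligible event the longest run is shorter than m exactly when no window is bad
(`RunFree`).

Let A_n be the probability of no bad window in n tosses, F that of a given window being bad, and π
that of a bad window followed by m good ones at the next m starting points (`RunOnlyAtStart` in 2m
tosses). Then A_n - A_{n+1} is the probability that only the first of n+1 tosses starts a bad
window. Distant stretches are independent, so this is π A_n + O(m F²), whence A_N = exp(-Nπ) + O(m F
+ N m F²) (`abs_tossProb_runFree_sub_exp_le`). As N F turns out to be bounded, the error is O(log N
/ N).

Comparing overlapping windows turns π into p(1-p) times the probability that one word of m-1 tosses
has T tails and never leads another in tails (`tossProb_runOnlyAtStart_two_mul`). First-toss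
recursions evaluate this for T = 1, 2, giving π = `clumpRate` · (1 - T/(q₀ m) + O(1/m²)).

Finally, -log(Nπ)/ln(1/p) is, up to O(1/m²), m - T log m + T/(c q₀ m) minus log(qN) and a constant.
The centering solves this equation up to O((log N)⁻²) (`isBigO_centering_equation`), so Nπ agrees to
that order with the power of p in the statement. That power is bounded, so the absolute error is
also a relative one. -/

/-! ### Toss probabilities as recursions over lists. -/

/-- The mean of `f` over the lists of `n` independent tosses of a coin with heads probability
`p`. -/
noncomputable def tossMean (p : ℝ) : ℕ → (List Bool → ℝ) → ℝ
  | 0, f => f []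
  | n + 1, f => p * tossMean p n (fun l => f (true :: l)) +
      (1 - p) * tossMean p n (fun l => f (false :: l))

open Classical in
/-- The probability that `n` independent tosses have the property `S`. -/
noncomputable def tossProb (p : ℝ) (n : ℕ) (S : List Bool → Prop) : ℝ :=
  tossMean p n (fun l => if S l then 1 else 0)

theorem tossMean_congr {p : ℝ} {n : ℕ} {f g : List Bool → ℝ}
    (h : ∀ l, l.length = n → f l = g l) : tossMean p n f = tossMean p n g := by
  induction n generalizing f g with
  | zero => exact h [] rfl
  | succ n ih =>
    simp only [tossMean]
    rw [ih (fun l hl => h (true :: l) (by simp [hl])),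
      ih (fun l hl => h (false :: l) (by simp [hl]))]

theorem tossMean_mono {p : ℝ} (hp0 : 0 ≤ p) (hp1 : p ≤ 1) {n : ℕ} {f g : List Bool → ℝ}
    (h : ∀ l, l.length = n → f l ≤ g l) : tossMean p n f ≤ tossMean p n g := by
  induction n generalizing f g with
  | zero => exact h [] rfl
  | succ n ih =>
    simp only [tossMean]
    have h1 := ih (fun l hl => h (true :: l) (by simp [hl]))
    have h2 := ih (fun l hl => h (false :: l) (by simp [hl]))
    have : 0 ≤ 1 - p := by linarith
    gcongr

theorem tossMean_add (p : ℝ) (n : ℕ) (f g : List Bool → ℝ) :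
    tossMean p n (fun l => f l + g l) = tossMean p n f + tossMean p n g := by
  induction n generalizing f g with
  | zero => rfl
  | succ n ih => simp only [tossMean, ih]; ring

theorem tossMean_const_mul (p : ℝ) (n : ℕ) (a : ℝ) (f : List Bool → ℝ) :
    tossMean p n (fun l => a * f l) = a * tossMean p n f := by
  induction n generalizing f with
  | zero => rfl
  | succ n ih => simp only [tossMean, ih]; ring

theorem tossMean_const (p : ℝ) (n : ℕ) (a : ℝ) : tossMean p n (fun _ => a) = a := by
  induction n with
  | zero => rfl
  | succ n ih => simp only [tossMean, ih]; ring

theorem tossMean_append (p : ℝ) (a b : ℕ) (f : List Bool → ℝ) :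
    tossMean p (a + b) f = tossMean p a (fun u => tossMean p b (fun v => f (u ++ v))) := by
  induction a generalizing f with
  | zero => simp [tossMean]
  | succ a ih =>
    rw [Nat.succ_add]
    simp only [tossMean, ih, List.cons_append]

theorem tossProb_congr {p : ℝ} {n : ℕ} {S S' : List Bool → Prop}
    (h : ∀ l, l.length = n → (S l ↔ S' l)) : tossProb p n S = tossProb p n S' := by
  classical
  exact tossMean_congr fun l hl => if_congr (h l hl) rfl rfl

theorem tossProb_mono {p : ℝ} (hp0 : 0 ≤ p) (hp1 : p ≤ 1) {n : ℕ} {S S' : List Bool → Prop}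
    (h : ∀ l, l.length = n → S l → S' l) : tossProb p n S ≤ tossProb p n S' := by
  classical
  refine tossMean_mono hp0 hp1 fun l hl => ?_
  have := h l hl
  split_ifs <;> simp_all

theorem tossProb_nonneg {p : ℝ} (hp0 : 0 ≤ p) (hp1 : p ≤ 1) (n : ℕ) (S : List Bool → Prop) :
    0 ≤ tossProb p n S := by
  classical
  rw [← tossMean_const p n 0]
  refine tossMean_mono hp0 hp1 fun l _ => ?_
  split_ifs <;> simp

theorem tossProb_true (p : ℝ) (n : ℕ) : tossProb p n (fun _ => True) = 1 := by
  simp [tossProb, tossMean_const]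

theorem tossProb_le_one {p : ℝ} (hp0 : 0 ≤ p) (hp1 : p ≤ 1) (n : ℕ) (S : List Bool → Prop) :
    tossProb p n S ≤ 1 :=
  (tossProb_mono hp0 hp1 fun _ _ _ => trivial).trans_eq (tossProb_true p n)

theorem tossProb_or_le {p : ℝ} (hp0 : 0 ≤ p) (hp1 : p ≤ 1) (n : ℕ) (S S' : List Bool → Prop) :
    tossProb p n (fun l => S l ∨ S' l) ≤ tossProb p n S + tossProb p n S' := by
  classical
  unfold tossProb
  rw [← tossMean_add]
  refine tossMean_mono hp0 hp1 fun l _ => ?_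
  by_cases h : S l <;> by_cases h' : S' l <;> simp [h, h']

theorem tossProb_and_add_and_not (p : ℝ) (n : ℕ) (S S' : List Bool → Prop) :
    tossProb p n (fun l => S l ∧ S' l) + tossProb p n (fun l => S l ∧ ¬ S' l) =
      tossProb p n S := by
  classical
  unfold tossProb
  rw [← tossMean_add]
  refine tossMean_congr fun l _ => ?_
  by_cases h : S l <;> by_cases h' : S' l <;> simp [h, h']

theorem tossProb_succ (p : ℝ) (n : ℕ) (S : List Bool → Prop) :
    tossProb p (n + 1) S = p * tossProb p n (fun l => S (true :: l)) +
      (1 - p) * tossProb p n (fun l => S (false :: l)) := rfl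

/-- Disjoint stretches of tosses are independent. -/
theorem tossProb_take_and_drop (p : ℝ) (a b : ℕ) (S S' : List Bool → Prop) :
    tossProb p (a + b) (fun l => S (l.take a) ∧ S' (l.drop a)) =
      tossProb p a S * tossProb p b S' := by
  classical
  unfold tossProb
  rw [tossMean_append, mul_comm, ← tossMean_const_mul]
  refine tossMean_congr fun u hu => ?_
  rw [mul_comm, ← tossMean_const_mul]
  refine tossMean_congr fun v _ => ?_
  subst hu
  simp only [List.take_left, List.drop_left]
  by_cases h : S u <;> by_cases h' : S' v <;> simp [h, h']

theorem tossProb_drop (p : ℝ) (a b : ℕ) (S : List Bool → Prop) :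
    tossProb p (a + b) (fun l => S (l.drop a)) = tossProb p b S := by
  simpa [tossProb_true] using tossProb_take_and_drop p a b (fun _ => True) S

theorem tossProb_take (p : ℝ) (a b : ℕ) (S : List Bool → Prop) :
    tossProb p (a + b) (fun l => S (l.take a)) = tossProb p a S := by
  simpa [tossProb_true] using tossProb_take_and_drop p a b S (fun _ => True)

/-! ### Windows with few tails. -/

/-- No `m` consecutive tosses contain at most `T` tails. -/
def RunFree (T m : ℕ) (l : List Bool) : Prop :=
  ∀ s, s + m ≤ l.length → T < ((l.drop s).take m).count false

/-- The first `m` tosses contain at most `T` tails, and no other `m` consecutive tosses do. -/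
def RunOnlyAtStart (T m : ℕ) (l : List Bool) : Prop :=
  (l.take m).count false ≤ T ∧ RunFree T m l.tail

theorem RunFree.drop {T m : ℕ} {l : List Bool} (h : RunFree T m l) (a : ℕ) :
    RunFree T m (l.drop a) := by
  intro s hs
  rw [List.drop_drop]
  -- For m = 0 a window past the end of `l` could pass the truncated length test; but then `RunFree`
  -- is already contradictory at position 0.
  by_cases hm : m = 0
  · subst hm
    simpa using h 0 (by simp)
  · refine h _ ?_
    rw [List.length_drop] at hs
    omega

theorem RunFree.take {T m : ℕ} {l : List Bool} (h : RunFree T m l) (a : ℕ) :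
    RunFree T m (l.take a) := by
  intro s hs
  rw [List.length_take] at hs
  rw [List.drop_take, List.take_take, min_eq_left (by omega)]
  exact h s (by omega)

/-- The two stretches overlap in at least m - 1 tosses, so every window lies inside one of them. -/
theorem RunFree.of_take_of_drop {T m : ℕ} {l : List Bool} {a b : ℕ} (h : RunFree T m (l.take b))
    (h' : RunFree T m (l.drop a)) (hab : a + m ≤ b + 1) : RunFree T m l := by
  intro s hs
  rcases le_or_gt (s + m) b with hb | hb
  · have := h s (by rw [List.length_take]; omega)
    rwa [List.drop_take, List.take_take, min_eq_left (by omega)] at this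
  · have := h' (s - a) (by rw [List.length_drop]; omega)
    rwa [List.drop_drop, show a + (s - a) = s by omega] at this

theorem runFree_cons_iff {T m : ℕ} {x : Bool} {l : List Bool} (hm : m ≤ l.length + 1) :
    RunFree T m (x :: l) ↔ RunFree T m l ∧ T < ((x :: l).take m).count false := by
  constructor
  · intro h
    exact ⟨by simpa using h.drop 1, by simpa using h 0 (by simpa using hm)⟩
  · rintro ⟨h, h'⟩ s hs
    cases s with
    | zero => simpa using h'
    | succ s => exact h s (by simp at hs; omega)

theorem abs_one_sub_pow_sub_exp_le {x : ℝ} (h0 : 0 ≤ x) (h1 : x ≤ 1) (n : ℕ) :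
    |(1 - x) ^ n - Real.exp (-(n * x))| ≤ n * x ^ 2 := by
  have hx : |(1 - x) - Real.exp (-x)| ≤ x ^ 2 := by
    have := Real.abs_exp_sub_one_sub_id_le (x := -x) (by rwa [abs_neg, abs_of_nonneg h0])
    rw [abs_sub_comm]
    simpa [sub_eq_add_neg, add_assoc, add_comm, add_left_comm] using this
  induction n with
  | zero => simp
  | succ n ih =>
    have he : Real.exp (-((n + 1 : ℕ) * x)) = Real.exp (-x) * Real.exp (-(n * x)) := by
      rw [← Real.exp_add]; congr 1; push_cast; ring
    have e1 : |Real.exp (-(n * x))| ≤ 1 := by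
      rw [abs_of_pos (Real.exp_pos _), Real.exp_le_one_iff, neg_nonpos]
      positivity
    have e2 : |1 - x| ≤ 1 := by
      rw [abs_le]
      constructor <;> linarith
    calc |(1 - x) ^ (n + 1) - Real.exp (-((n + 1 : ℕ) * x))|
        = |(1 - x) * ((1 - x) ^ n - Real.exp (-(n * x))) +
            ((1 - x) - Real.exp (-x)) * Real.exp (-(n * x))| := by rw [he]; ring_nf
      _ ≤ 1 * (n * x ^ 2) + x ^ 2 * 1 := by
        refine (abs_add_le _ _).trans ?_
        rw [abs_mul, abs_mul]
        gcongr
      _ = _ := by push_cast; ring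

/-! ### The approximate geometric decay of the no-run probability. -/

section Recursion

variable {p : ℝ} {T m : ℕ}

/-- Prefix one toss to a run-free sequence of length n: the only new window is the first one, and it
is either good or bad. -/
theorem tossProb_runFree_eq_add {n : ℕ} (hm : m ≤ n + 1) :
    tossProb p n (RunFree T m) =
      tossProb p (n + 1) (RunFree T m) + tossProb p (n + 1) (RunOnlyAtStart T m) := by
  have h := tossProb_and_add_and_not p (n + 1) (fun l => RunFree T m l.tail)
    (fun l => T < (l.take m).count false)
  have h1 : tossProb p (n + 1) (fun l => RunFree T m l.tail) = tossProb p n (RunFree T m) := by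
    rw [tossProb_succ]; simp only [List.tail_cons]; ring
  rw [h1] at h
  rw [← h]
  congr 1
  · refine tossProb_congr fun l hl => ?_
    cases l with
    | nil => simp at hl
    | cons x l => rw [runFree_cons_iff (by simp at hl; omega)]; rfl
  · refine tossProb_congr fun l hl => ?_
    simp only [RunOnlyAtStart, not_lt]
    tauto

theorem tossProb_runFree_of_lt {n : ℕ} (hm : n < m) : tossProb p n (RunFree T m) = 1 := by
  rw [← tossProb_true p n]
  refine tossProb_congr fun l hl => ?_
  simp only [iff_true]
  intro s hs
  omega

variable (hp0 : 0 ≤ p) (hp1 : p ≤ 1)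
include hp0 hp1

theorem tossProb_runOnlyAtStart_le (r : ℕ) :
    tossProb p (m + r) (RunOnlyAtStart T m) ≤ tossProb p m (fun l => l.count false ≤ T) := by
  rw [← tossProb_take p m r]
  exact tossProb_mono hp0 hp1 fun l _ h => h.1

theorem tossProb_runFree_succ_le (n : ℕ) :
    tossProb p (n + 1) (RunFree T m) ≤ tossProb p n (RunFree T m) := by
  rw [add_comm, ← tossProb_drop p 1 n (RunFree T m)]
  exact tossProb_mono hp0 hp1 fun l _ h => h.drop 1

theorem tossProb_runFree_sub_succ_le (n : ℕ) :
    tossProb p n (RunFree T m) - tossProb p (n + 1) (RunFree T m) ≤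
      tossProb p m (fun l => l.count false ≤ T) := by
  rcases lt_or_ge (n + 1) m with h | h
  · rw [tossProb_runFree_of_lt h, tossProb_runFree_of_lt (by omega), sub_self]
    exact tossProb_nonneg hp0 hp1 _ _
  · rw [tossProb_runFree_eq_add h]
    have := tossProb_runOnlyAtStart_le (T := T) (m := m) hp0 hp1 (n + 1 - m)
    rw [Nat.add_sub_cancel' h] at this
    linarith

theorem tossProb_runFree_sub_add_le (n r : ℕ) :
    tossProb p n (RunFree T m) - tossProb p (n + r) (RunFree T m) ≤
      r * tossProb p m (fun l => l.count false ≤ T) := by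
  induction r with
  | zero => simp
  | succ r ih =>
    have := tossProb_runFree_sub_succ_le (T := T) (m := m) hp0 hp1 (n + r)
    push_cast
    rw [← add_assoc n r 1]
    linarith

theorem tossProb_runFree_add_le (n r : ℕ) :
    tossProb p (n + r) (RunFree T m) ≤ tossProb p n (RunFree T m) := by
  induction r with
  | zero => simp
  | succ r ih => exact (tossProb_runFree_succ_le hp0 hp1 (n + r)).trans ih

/-- Forgetting the windows that straddle position 2m leaves two independent events. -/
theorem tossProb_runOnlyAtStart_add_le (hm : 0 < m) (r : ℕ) :
    tossProb p (2 * m + r) (RunOnlyAtStart T m) ≤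
      tossProb p (2 * m) (RunOnlyAtStart T m) * tossProb p r (RunFree T m) := by
  rw [← tossProb_take_and_drop]
  refine tossProb_mono hp0 hp1 fun l hl h => ⟨⟨?_, ?_⟩, ?_⟩
  · rw [List.take_take, min_eq_left (by omega)]
    exact h.1
  · cases l with
    | nil => simp at hl; omega
    | cons x l =>
      obtain ⟨j, hj⟩ : ∃ j, 2 * m = j + 1 := ⟨2 * m - 1, by omega⟩
      rw [hj, List.take_succ_cons]
      exact h.2.take j
  · have := h.2.drop (2 * m - 1)
    rwa [← List.drop_one, List.drop_drop, show 1 + (2 * m - 1) = 2 * m by omega] at this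

/-- Converse to the preceding bound. The product event fails to be a lone run at the start only if
some window meeting both stretches is bad. Such a window lies beyond the first m tosses, so it is
independent of the first window; this yields the product in the error term. -/
theorem le_tossProb_runOnlyAtStart_add (hm : 0 < m) (r : ℕ) :
    tossProb p (2 * m) (RunOnlyAtStart T m) * tossProb p r (RunFree T m) ≤
      tossProb p (2 * m + r) (RunOnlyAtStart T m) +
        tossProb p m (fun l => l.count false ≤ T) *
          (tossProb p r (RunFree T m) - tossProb p (r + m) (RunFree T m)) := by
  have h1 : tossProb p r (RunFree T m) - tossProb p (r + m) (RunFree T m) =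
      tossProb p (m + r) (fun l => RunFree T m (l.drop m) ∧ ¬ RunFree T m l) := by
    rw [← tossProb_drop p m r (RunFree T m), ← tossProb_and_add_and_not p (m + r)
      (fun l => RunFree T m (l.drop m)) (RunFree T m), add_comm r m]
    rw [tossProb_congr (S' := RunFree T m) fun l _ => ⟨And.right, fun h => ⟨h.drop m, h⟩⟩]
    ring
  rw [h1, ← tossProb_take_and_drop, ← tossProb_take_and_drop, show 2 * m + r = m + (m + r) by ring]
  refine (tossProb_mono hp0 hp1 fun l hl h => ?_).trans (tossProb_or_le hp0 hp1 _ _ _)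
  obtain ⟨⟨h2, h3⟩, h4⟩ := h
  rw [List.take_take, min_eq_left (by omega)] at h2
  by_cases h5 : RunFree T m (l.drop m)
  · refine Or.inl ⟨h2, ?_⟩
    -- Positions are shifted by one because the first toss has been removed by `tail`.
    refine RunFree.of_take_of_drop (a := m - 1) (b := 2 * m - 1) ?_ ?_ (by omega)
    · rwa [← List.drop_one, List.take_drop, show 1 + (2 * m - 1) = 2 * m by omega, List.drop_one]
    · rwa [← List.drop_one, List.drop_drop, show 1 + (m - 1) = m by omega]
  · refine Or.inr ⟨h2, ?_, h5⟩
    rwa [List.drop_drop, ← two_mul]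

/-- Up to a small error, each further toss multiplies the probability of having no run by the
same factor. -/
theorem abs_tossProb_runFree_succ_sub_le (hm : 0 < m) {n : ℕ} (hn : 2 * m ≤ n + 1) :
    |tossProb p (n + 1) (RunFree T m) -
        (1 - tossProb p (2 * m) (RunOnlyAtStart T m)) * tossProb p n (RunFree T m)| ≤
      2 * m * tossProb p m (fun l => l.count false ≤ T) ^ 2 := by
  obtain ⟨r, hr⟩ := Nat.exists_eq_add_of_le hn
  have h1 := tossProb_runFree_eq_add (p := p) (T := T) (show m ≤ n + 1 by omega)
  have h2 := tossProb_runOnlyAtStart_add_le (T := T) hp0 hp1 hm r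
  have h3 := le_tossProb_runOnlyAtStart_add (T := T) hp0 hp1 hm r
  have h4 := tossProb_runFree_sub_add_le (T := T) (m := m) hp0 hp1 r m
  have h5 := tossProb_runFree_sub_add_le (T := T) (m := m) hp0 hp1 r (2 * m - 1)
  have h6 := tossProb_runFree_add_le (T := T) (m := m) hp0 hp1 r (2 * m - 1)
  have h7 := tossProb_runOnlyAtStart_le (T := T) (m := m) hp0 hp1 m
  have h8 := tossProb_nonneg hp0 hp1 (2 * m) (RunOnlyAtStart T m)
  have h9 := tossProb_nonneg hp0 hp1 m (fun l => l.count false ≤ T)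
  rw [← hr] at h2 h3
  rw [show r + (2 * m - 1) = n by omega] at h5 h6
  rw [← two_mul] at h7
  have hc : ((2 * m - 1 : ℕ) : ℝ) ≤ 2 * m := by
    rw [Nat.cast_sub (by omega)]; push_cast; linarith
  generalize tossProb p (2 * m) (RunOnlyAtStart T m) = π at *
  generalize tossProb p m (fun l => l.count false ≤ T) = F at *
  generalize tossProb p n (RunFree T m) = A at *
  generalize tossProb p (n + 1) (RunFree T m) = A' at *
  generalize tossProb p r (RunFree T m) = B at *
  generalize tossProb p (n + 1) (RunOnlyAtStart T m) = d at *
  -- Replacing the r remaining tosses by n = r + 2m - 1 costs at most 2mF in the no-run probability,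
  -- and π ≤ F. This gives the constant of the lower estimate; the upper one needs only m F².
  have h10 : π * (B - A) ≤ F * (2 * m * F) := by
    refine mul_le_mul h7 (h5.trans ?_) (by linarith) h9
    gcongr
  have h11 := mul_le_mul_of_nonneg_left h4 h9
  have h12 : 0 ≤ π * (B - A) := mul_nonneg h8 (by linarith)
  have h13 : 0 ≤ (m : ℝ) * F ^ 2 := by positivity
  rw [abs_le]
  constructor <;> nlinarith

/-- For short sequences both quantities lie within 2mF below 1, by the union bound and by
Bernoulli's inequality. This starts the induction, whose step needs 2m tosses. -/
theorem abs_tossProb_runFree_sub_pow_le_of_le (hm : 0 < m) {n : ℕ} (hn : n ≤ 2 * m) :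
    |tossProb p n (RunFree T m) - (1 - tossProb p (2 * m) (RunOnlyAtStart T m)) ^ n| ≤
      2 * m * tossProb p m (fun l => l.count false ≤ T) := by
  have h7 := tossProb_runOnlyAtStart_le (T := T) (m := m) hp0 hp1 m
  rw [← two_mul] at h7
  have h8 := tossProb_nonneg hp0 hp1 (2 * m) (RunOnlyAtStart T m)
  have h8' := tossProb_le_one hp0 hp1 (2 * m) (RunOnlyAtStart T m)
  have h9 := tossProb_nonneg hp0 hp1 m (fun l => l.count false ≤ T)
  have h1 := tossProb_runFree_sub_add_le (T := T) (m := m) hp0 hp1 0 n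
  have h2 := tossProb_le_one hp0 hp1 n (RunFree T m)
  rw [zero_add, tossProb_runFree_of_lt hm] at h1
  have h3 : 1 + (n : ℝ) * -tossProb p (2 * m) (RunOnlyAtStart T m) ≤
      (1 + -tossProb p (2 * m) (RunOnlyAtStart T m)) ^ n :=
    one_add_mul_le_pow (by linarith) n
  rw [← sub_eq_add_neg] at h3
  have h4 : (1 - tossProb p (2 * m) (RunOnlyAtStart T m)) ^ n ≤ 1 :=
    pow_le_one₀ (by linarith) (by linarith)
  have hn' : (n : ℝ) ≤ 2 * m := by exact_mod_cast hn
  have h5 := mul_le_mul hn' h7 h8 (by positivity)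
  have h6 := mul_le_mul_of_nonneg_right hn' h9
  rw [abs_le]
  constructor <;> linarith

theorem abs_tossProb_runFree_sub_pow_le (hm : 0 < m) (n : ℕ) :
    |tossProb p n (RunFree T m) - (1 - tossProb p (2 * m) (RunOnlyAtStart T m)) ^ n| ≤
      2 * m * tossProb p m (fun l => l.count false ≤ T) +
        n * (2 * m * tossProb p m (fun l => l.count false ≤ T) ^ 2) := by
  have h8 := tossProb_nonneg hp0 hp1 (2 * m) (RunOnlyAtStart T m)
  have h8' := tossProb_le_one hp0 hp1 (2 * m) (RunOnlyAtStart T m)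
  rcases le_total n (2 * m) with hn | hn
  · refine (abs_tossProb_runFree_sub_pow_le_of_le hp0 hp1 hm hn).trans ?_
    exact le_add_of_nonneg_right (by positivity)
  · induction n, hn using Nat.le_induction with
    | base =>
      refine (abs_tossProb_runFree_sub_pow_le_of_le hp0 hp1 hm le_rfl).trans ?_
      exact le_add_of_nonneg_right (by positivity)
    | succ n hn ih =>
      have h := abs_tossProb_runFree_succ_sub_le (T := T) hp0 hp1 hm (n := n) (by omega)
      generalize tossProb p (2 * m) (RunOnlyAtStart T m) = π at *
      have h1 : |(1 - π) * (tossProb p n (RunFree T m) - (1 - π) ^ n)| ≤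
          |tossProb p n (RunFree T m) - (1 - π) ^ n| := by
        rw [abs_mul]
        refine mul_le_of_le_one_left (abs_nonneg _) ?_
        rw [abs_le]
        constructor <;> linarith
      calc _ = |(tossProb p (n + 1) (RunFree T m) - (1 - π) * tossProb p n (RunFree T m)) +
            (1 - π) * (tossProb p n (RunFree T m) - (1 - π) ^ n)| := by ring_nf
        _ ≤ _ := (abs_add_le _ _).trans (add_le_add h (h1.trans ih))
        _ = _ := by push_cast; ring

/-- The probability of having no run in `n` tosses is close to an exponential. -/
theorem abs_tossProb_runFree_sub_exp_le (hm : 0 < m) (n : ℕ) :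
    |tossProb p n (RunFree T m) -
        Real.exp (-(n * tossProb p (2 * m) (RunOnlyAtStart T m)))| ≤
      2 * m * tossProb p m (fun l => l.count false ≤ T) +
        n * (3 * m * tossProb p m (fun l => l.count false ≤ T) ^ 2) := by
  have h7 := tossProb_runOnlyAtStart_le (T := T) (m := m) hp0 hp1 m
  rw [← two_mul] at h7
  have h8 := tossProb_nonneg hp0 hp1 (2 * m) (RunOnlyAtStart T m)
  have h8' := tossProb_le_one hp0 hp1 (2 * m) (RunOnlyAtStart T m)
  have h1 := abs_tossProb_runFree_sub_pow_le (T := T) hp0 hp1 hm n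
  have h2 := abs_one_sub_pow_sub_exp_le h8 h8' n
  have h3 := (abs_sub_le _ _ _).trans (add_le_add h1 h2)
  have h4 := pow_le_pow_left₀ h8 h7 2
  have hm' : (1 : ℝ) ≤ m := by exact_mod_cast hm
  -- The factor 3m is 2m from the recursion plus 1 ≤ m from replacing the power by an exponential.
  have h5 : tossProb p m (fun l => l.count false ≤ T) ^ 2 ≤
      m * tossProb p m (fun l => l.count false ≤ T) ^ 2 :=
    le_mul_of_one_le_left (by positivity) hm'
  have h6 := mul_le_mul_of_nonneg_left (h4.trans h5) (Nat.cast_nonneg (α := ℝ) n)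
  linarith

end Recursion

/-! ### Number of tails in a window. -/

/-- A crude bound, but of the right order n^T p^n; this makes N F bounded at the length of interest.
-/
theorem mul_tossProb_count_le_le {p : ℝ} (hp0 : 0 ≤ p) (hp1 : p ≤ 1) (T n : ℕ) :
    p ^ T * tossProb p n (fun l => l.count false ≤ T) ≤ (n + 1) ^ T * p ^ n := by
  induction n generalizing T with
  | zero =>
    have := tossProb_le_one hp0 hp1 0 (fun l => l.count false ≤ T)
    have h1 := tossProb_nonneg hp0 hp1 0 (fun l => l.count false ≤ T)
    simpa using mul_le_one₀ (pow_le_one₀ hp0 hp1) h1 this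
  | succ n ih =>
    have hq : 0 ≤ 1 - p := by linarith
    rw [tossProb_succ]
    cases T with
    | zero =>
      have h0 : tossProb p n (fun l => (false :: l).count false ≤ 0) = 0 := by
        simp [tossProb, tossMean_const]
      have h1 := ih 0
      rw [h0]
      simp only [pow_zero, one_mul, mul_zero, add_zero] at h1 ⊢
      rw [pow_succ']
      simpa using mul_le_mul_of_nonneg_left h1 hp0
    | succ T =>
      have h1 := mul_le_mul_of_nonneg_left (ih (T + 1)) hp0
      have h2 := mul_le_mul_of_nonneg_left (ih T) (mul_nonneg hp0 hq)
      have e1 : ∀ l : List Bool, (true :: l).count false = l.count false := by simp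
      have e2 : ∀ l : List Bool, ((false :: l).count false ≤ T + 1) = (l.count false ≤ T) := by
        simp
      simp only [e1, e2]
      have h3 : p * (1 - p) * ((n + 1 : ℝ) ^ T * p ^ n) ≤ p * ((n + 1 : ℝ) ^ T * p ^ n) := by
        refine mul_le_mul_of_nonneg_right ?_ (by positivity)
        nlinarith
      have h4 : (n + 1 : ℝ) ^ T ≤ (n + 1 + 1) ^ T := by gcongr; linarith
      have h5 : p ^ (n + 1) * ((n + 1 : ℝ) ^ T * (n + 1 + 1)) ≤
          p ^ (n + 1) * ((n + 1 + 1) ^ T * (n + 1 + 1)) := by gcongr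
      push_cast
      calc _ = p * (p ^ (T + 1) * tossProb p n fun l => l.count false ≤ T + 1) +
            p * (1 - p) * (p ^ T * tossProb p n fun l => l.count false ≤ T) := by ring
        _ ≤ p * ((n + 1) ^ (T + 1) * p ^ n) + p * ((n + 1 : ℝ) ^ T * p ^ n) := by linarith
        _ = p ^ (n + 1) * ((n + 1 : ℝ) ^ T * (n + 1 + 1)) := by ring
        _ ≤ _ := by linarith [h5, show p ^ (n + 1) * ((n + 1 + 1 : ℝ) ^ T * (n + 1 + 1)) =
            (n + 1 + 1) ^ (T + 1) * p ^ (n + 1) by ring]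

theorem tossProb_count_eq_zero (p : ℝ) (n : ℕ) :
    tossProb p n (fun l => l.count false = 0) = p ^ n := by
  induction n with
  | zero => simp [tossProb, tossMean]
  | succ n ih =>
    have h0 : tossProb p n (fun l => (false :: l).count false = 0) = 0 := by
      simp [tossProb, tossMean_const]
    rw [tossProb_succ, h0, tossProb_congr (S' := fun l => l.count false = 0) (by simp), ih]
    ring

theorem tossProb_count_eq_succ (p : ℝ) (n T : ℕ) :
    tossProb p (n + 1) (fun l => l.count false = T + 1) =
      p * tossProb p n (fun l => l.count false = T + 1) +
        (1 - p) * tossProb p n (fun l => l.count false = T) := by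
  rw [tossProb_succ]
  simp

theorem mul_tossProb_count_eq_one (p : ℝ) (n : ℕ) :
    p * tossProb p n (fun l => l.count false = 1) = n * (1 - p) * p ^ n := by
  induction n with
  | zero => simp [tossProb, tossMean]
  | succ n ih =>
    rw [tossProb_count_eq_succ, tossProb_count_eq_zero, mul_add, ih]
    push_cast; ring

theorem sq_mul_tossProb_count_eq_two (p : ℝ) (n : ℕ) :
    p ^ 2 * tossProb p n (fun l => l.count false = 2) =
      n * (n - 1) / 2 * (1 - p) ^ 2 * p ^ n := by
  induction n with
  | zero => simp [tossProb, tossMean]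
  | succ n ih =>
    rw [tossProb_count_eq_succ]
    have := mul_tossProb_count_eq_one p n
    push_cast
    linear_combination p * ih + p * (1 - p) * this

/-! ### One sequence of tosses never leading another in tails. -/

/-- The probability that, of two sequences of `n` tosses, the first contains exactly `T` tails,
and at no time has it shown over `e` tails more than the second. -/
noncomputable def leadProb (p : ℝ) (n T e : ℕ) : ℝ :=
  tossMean p n fun z => tossProb p n fun y =>
    z.count false = T ∧ ∀ s ≤ n, (z.take s).count false ≤ e + (y.take s).count false

theorem tossMean_tossProb_succ (p : ℝ) (n : ℕ) (S : List Bool → List Bool → Prop) :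
    (tossMean p (n + 1) fun z => tossProb p (n + 1) (S z)) =
      p * (p * (tossMean p n fun z => tossProb p n fun y => S (true :: z) (true :: y)) +
        (1 - p) * tossMean p n fun z => tossProb p n fun y => S (true :: z) (false :: y)) +
      (1 - p) * (p * (tossMean p n fun z => tossProb p n fun y => S (false :: z) (true :: y)) +
        (1 - p) * tossMean p n fun z => tossProb p n fun y => S (false :: z) (false :: y)) := by
  simp only [tossProb_succ]
  rw [tossMean]
  simp only [tossMean_add, tossMean_const_mul]

theorem forall_le_succ_iff {n : ℕ} {C : ℕ → Prop} :
    (∀ s ≤ n + 1, C s) ↔ C 0 ∧ ∀ s ≤ n, C (s + 1) := by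
  constructor
  · exact fun h => ⟨h 0 (by omega), fun s hs => h (s + 1) (by omega)⟩
  · rintro ⟨h0, h⟩ (_ | s) hs
    · exact h0
    · exact h s (by omega)

/-- With only T tails available a lead above e ≥ T is impossible. These are the boundary values at
which the recursions below stop. -/
theorem leadProb_of_le (p : ℝ) {n T e : ℕ} (h : T ≤ e) :
    leadProb p n T e = tossProb p n fun l => l.count false = T := by
  refine tossMean_congr fun z _ => ?_
  have h1 : (tossProb p n fun y => z.count false = T ∧
      ∀ s ≤ n, (z.take s).count false ≤ e + (y.take s).count false) =
      tossProb p n fun _ => z.count false = T :=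
    tossProb_congr fun y _ => ⟨And.left, fun hz => ⟨hz, fun s _ => by
      have := (List.take_sublist s z).count_le false
      omega⟩⟩
  rw [h1]
  exact tossMean_const p n _

theorem leadProb_zero_length (p : ℝ) (T e : ℕ) : leadProb p 0 (T + 1) e = 0 := by
  simp [leadProb, tossProb, tossMean]

/-- A first pair head/tail raises the allowance to 1, equal tosses keep it, and tail/head violates
the condition at once, so that term vanishes. -/
theorem leadProb_succ_zero (p : ℝ) (n T : ℕ) :
    leadProb p (n + 1) (T + 1) 0 =
      p * (p * leadProb p n (T + 1) 0 + (1 - p) * leadProb p n (T + 1) 1) +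
        (1 - p) * ((1 - p) * leadProb p n T 0) := by
  suffices h : leadProb p (n + 1) (T + 1) 0 =
      p * (p * leadProb p n (T + 1) 0 + (1 - p) * leadProb p n (T + 1) 1) +
        (1 - p) * (p * 0 + (1 - p) * leadProb p n T 0) by
    rw [h]; ring
  unfold leadProb
  rw [tossMean_tossProb_succ]
  congr! 3
  · congr! 5 with z y
    simp [forall_le_succ_iff]
  · congr! 5 with z y
    simp [forall_le_succ_iff, add_comm]
  · have : (tossMean p n fun z => tossProb p n fun y => (false :: z).count false = T + 1 ∧
        ∀ s ≤ n + 1, ((false :: z).take s).count false ≤ 0 + ((true :: y).take s).count false) =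
        tossMean p n fun z => tossProb p n fun y => False := by
      congr! 4 with z y
      simp only [iff_false]
      rintro ⟨_, h⟩
      simpa using h 1 (by omega)
    rw [this]
    simp only [tossProb, if_false, tossMean_const]
  · congr! 5 with z y
    simp [forall_le_succ_iff]

theorem leadProb_succ_succ (p : ℝ) (n T e : ℕ) :
    leadProb p (n + 1) (T + 1) (e + 1) =
      p * (p * leadProb p n (T + 1) (e + 1) + (1 - p) * leadProb p n (T + 1) (e + 2)) +
        (1 - p) * (p * leadProb p n T e + (1 - p) * leadProb p n T (e + 1)) := by
  unfold leadProb
  rw [tossMean_tossProb_succ]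
  congr! 3
  · congr! 5 with z y
    simp [forall_le_succ_iff]
  · congr! 5 with z y
    simp only [List.count_cons, forall_le_succ_iff, List.take_succ_cons]
    refine and_congr (by simp) ?_
    simp
    grind
  · congr! 5 with z y
    simp only [List.count_cons, forall_le_succ_iff, List.take_succ_cons]
    refine and_congr (by simp) ?_
    simp
    grind
  · congr! 5 with z y
    simp [forall_le_succ_iff]
    grind

theorem mul_leadProb_one_zero (p : ℝ) (n : ℕ) :
    p * leadProb p n 1 0 = p ^ n * (n * (1 - p) - p + p ^ (n + 1)) := by
  induction n with
  | zero => simp [leadProb_zero_length]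
  | succ n ih =>
    rw [leadProb_succ_zero, leadProb_of_le p (le_refl 1), leadProb_of_le p (le_refl 0),
      tossProb_count_eq_zero]
    have := mul_tossProb_count_eq_one p n
    push_cast
    linear_combination p ^ 2 * ih + p * (1 - p) * this

section

variable {p : ℝ} (hp0 : 0 ≤ p) (hp1 : p ≤ 1)
include hp0 hp1

/-- Two tails can lead by more than 1 only if both precede every tail of the other sequence, an
event of order p^n. The factor p on the right is the one that closes the induction: p³ + p²(1-p) =
p². -/
theorem leadProb_two_one_bounds (n : ℕ) :
    0 ≤ p * (tossProb p n (fun l => l.count false = 2) - leadProb p n 2 1) ∧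
      p * (tossProb p n (fun l => l.count false = 2) - leadProb p n 2 1) ≤ p * p ^ n := by
  have hq : 0 ≤ 1 - p := by linarith
  induction n with
  | zero => simp [leadProb_zero_length, tossProb, tossMean, hp0]
  | succ n ih =>
    rw [leadProb_succ_succ, leadProb_of_le p (le_refl 1), leadProb_of_le p (le_refl 2),
      tossProb_count_eq_succ]
    have h1 := mul_tossProb_count_eq_one p n
    have h2 := mul_leadProb_one_zero p n
    have h3 : p ^ (n + 1) ≤ 1 := pow_le_one₀ hp0 hp1
    have h4 : p ^ (n + 1) ≤ p := by
      simpa using pow_le_pow_of_le_one hp0 hp1 (show 1 ≤ n + 1 by omega)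
    generalize tossProb p n (fun l => l.count false = 2) = b2 at *
    generalize tossProb p n (fun l => l.count false = 1) = b1 at *
    generalize leadProb p n 2 1 = H21 at *
    generalize leadProb p n 1 0 = H10 at *
    have key : p * (p * b2 + (1 - p) * b1 - (p * (p * H21 + (1 - p) * b2) +
        (1 - p) * (p * H10 + (1 - p) * b1))) =
        p ^ 2 * (p * (b2 - H21)) + p * (1 - p) * (p ^ n * (p - p ^ (n + 1))) := by
      linear_combination p * (1 - p) * h1 - p * (1 - p) * h2
    rw [key]
    have hn : 0 ≤ p ^ n := by positivity
    have hn1 : 0 ≤ p ^ (n + 1) := by positivity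
    constructor
    · have := mul_nonneg hn (sub_nonneg.2 h4)
      have := ih.1
      positivity
    · have e1 := mul_le_mul_of_nonneg_left ih.2 (sq_nonneg p)
      have e2 : p * (1 - p) * (p ^ n * (p - p ^ (n + 1))) ≤ p * (1 - p) * (p ^ n * p) := by
        gcongr; linarith
      calc _ ≤ p ^ 2 * (p * p ^ n) + p * (1 - p) * (p ^ n * p) := add_le_add e1 e2
        _ = _ := by ring

/-- The term n(1-p)p^n contributes at relative order 1/n, hence to q₀; the O(p^n) error has relative
order 1/n². -/
theorem leadProb_two_zero_bounds (n : ℕ) :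
    |p * (tossProb p n (fun l => l.count false = 2) - leadProb p n 2 0) - n * (1 - p) * p ^ n| ≤
      3 * p ^ n := by
  have hq : 0 ≤ 1 - p := by linarith
  induction n with
  | zero => simp [leadProb_zero_length, tossProb, tossMean]
  | succ n ih =>
    have h0 := leadProb_two_one_bounds hp0 hp1 n
    rw [leadProb_succ_zero, tossProb_count_eq_succ]
    have h1 := mul_tossProb_count_eq_one p n
    have h2 := mul_leadProb_one_zero p n
    generalize tossProb p n (fun l => l.count false = 2) = b2 at *
    generalize tossProb p n (fun l => l.count false = 1) = b1 at *
    generalize leadProb p n 2 1 = H21 at *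
    generalize leadProb p n 1 0 = H10 at *
    generalize leadProb p n 2 0 = H20 at *
    have key : p * (p * b2 + (1 - p) * b1 - (p * (p * H20 + (1 - p) * H21) +
        (1 - p) * ((1 - p) * H10))) - (n + 1 : ℕ) * (1 - p) * p ^ (n + 1) =
        p ^ 2 * (p * (b2 - H20) - n * (1 - p) * p ^ n) + p * (1 - p) * (p * (b2 - H21)) +
          p * (1 - p) * ((1 - p) * (p ^ n * (1 - p ^ n)) - p ^ n) := by
      push_cast
      linear_combination (1 - p) * h1 - (1 - p) ^ 2 * h2
    rw [key]
    have hn : 0 ≤ p ^ n := by positivity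
    have hn1 : p ^ n ≤ 1 := pow_le_one₀ hp0 hp1
    have e1 : |p * (b2 - H21)| ≤ p ^ n := by
      rw [abs_of_nonneg h0.1]
      nlinarith [h0.2]
    have e2 : |(1 - p) * (p ^ n * (1 - p ^ n)) - p ^ n| ≤ p ^ n := by
      have e3 : 0 ≤ (1 - p) * (p ^ n * (1 - p ^ n)) :=
        mul_nonneg hq (mul_nonneg hn (by linarith))
      have e4 : (1 - p) * (p ^ n * (1 - p ^ n)) ≤ 1 * (p ^ n * 1) :=
        mul_le_mul (by linarith) (by gcongr; linarith) (mul_nonneg hn (by linarith)) (by norm_num)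
      rw [abs_le]
      constructor <;> linarith
    have hpq : 0 ≤ p * (1 - p) := mul_nonneg hp0 hq
    refine (abs_add_three _ _ _).trans ?_
    rw [abs_mul, abs_mul (p * (1 - p)), abs_mul (p * (1 - p)), abs_of_nonneg (sq_nonneg p),
      abs_of_nonneg hpq]
    calc _ ≤ p ^ 2 * (3 * p ^ n) + p * (1 - p) * p ^ n + p * (1 - p) * p ^ n := by gcongr
      -- A spare third error term makes the constant reproduce itself: 3p² + 3p(1-p) = 3p.
      _ ≤ p ^ 2 * (3 * p ^ n) + p * (1 - p) * p ^ n + p * (1 - p) * p ^ n +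
          p * (1 - p) * p ^ n := le_add_of_nonneg_right (by positivity)
      _ = 3 * p ^ (n + 1) := by ring

end

/-! ### The clump probability in terms of the lead. -/

/-- The window a·z has at most T tails while z·b has more; this forces a to be a head, b a tail and
z to have exactly T tails. Sliding the window z·b by s then trades the first s tosses of z for those
of y, and the window stays good exactly when z does not lead y at time s. -/
theorem runOnlyAtStart_cons_append_cons_iff {T n : ℕ} {a b : Bool} {z y : List Bool}
    (hz : z.length = n) (hy : y.length = n) :
    RunOnlyAtStart T (n + 1) (a :: (z ++ b :: y)) ↔ a = true ∧ b = false ∧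
      z.count false = T ∧ ∀ s ≤ n, (z.take s).count false ≤ 0 + (y.take s).count false := by
  have h1 : ∀ s ≤ n, ((z ++ b :: y).drop s).take (n + 1) = z.drop s ++ b :: y.take s := by
    intro s hs
    rw [List.drop_append_of_le_length (by omega), List.take_append, List.length_drop,
      List.take_of_length_le (by rw [List.length_drop]; omega),
      show n + 1 - (z.length - s) = s + 1 by omega, List.take_succ_cons]
  have h2 : ∀ s, (z.take s).count false + (z.drop s).count false = z.count false := by
    intro s
    rw [← List.count_append, List.take_append_drop]
  have h3 : (z ++ b :: y).length = n + (n + 1) := by simp [hz, hy]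
  have h4 : (a :: (z ++ b :: y)).take (n + 1) = a :: z := by simp [hz]
  simp only [RunOnlyAtStart, RunFree, h3, h4, List.tail_cons]
  have h5 : (∀ s, s + (n + 1) ≤ n + (n + 1) →
      T < (((z ++ b :: y).drop s).take (n + 1)).count false) ↔
      ∀ s ≤ n, T < (z.drop s).count false + ((y.take s).count false + if b = false then 1 else 0) :=
    forall_congr' fun s => by
      constructor
      · intro h hs
        have := h (by omega)
        rw [h1 s hs, List.count_append, List.count_cons] at this
        simpa using this
      · intro h hs
        rw [h1 s (by omega), List.count_append, List.count_cons]
        simpa using h (by omega)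
  rw [h5, List.count_cons]
  constructor
  · rintro ⟨h6, h7⟩
    have h8 := h7 0 (by omega)
    simp only [List.drop_zero, List.take_zero, List.count_nil, zero_add] at h8
    cases a <;> cases b <;> simp at h6 h8 h7 ⊢
    · omega
    · omega
    · refine ⟨by omega, fun s hs => ?_⟩
      have := h7 s hs
      have := h2 s
      omega
    · omega
  · rintro ⟨rfl, rfl, h6, h7⟩
    refine ⟨by simp [h6], fun s hs => ?_⟩
    have := h7 s hs
    have := h2 s
    simp
    omega

theorem tossProb_runOnlyAtStart_two_mul (p : ℝ) (T n : ℕ) :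
    tossProb p (2 * (n + 1)) (RunOnlyAtStart T (n + 1)) = p * (1 - p) * leadProb p n T 0 := by
  classical
  have hF : ∀ k, tossMean p k (fun _ => (0 : ℝ)) = 0 := fun k => tossMean_const p k 0
  have key : ∀ a b : Bool, (tossMean p n fun z => tossProb p n fun y =>
      RunOnlyAtStart T (n + 1) (a :: (z ++ b :: y))) =
      if a = true ∧ b = false then leadProb p n T 0 else 0 := by
    intro a b
    split_ifs with hab
    · refine tossMean_congr fun z hz => tossProb_congr fun y hy => ?_
      rw [runOnlyAtStart_cons_append_cons_iff hz hy]
      tauto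
    · rw [← hF n]
      refine tossMean_congr fun z hz => ?_
      rw [← hF n]
      refine tossMean_congr fun y hy => if_neg ?_
      beta_reduce
      rw [runOnlyAtStart_cons_append_cons_iff hz hy]
      tauto
  simp only [tossProb] at key
  unfold tossProb
  rw [show 2 * (n + 1) = (n + (n + 1)) + 1 by ring, tossMean]
  simp only [tossMean_append p n (n + 1)]
  simp only [tossMean, tossMean_add, tossMean_const_mul, key]
  simp
  ring

/-! ### From random variables to lists. -/

theorem tossMean_eq_sum (p : ℝ) (n : ℕ) (f : List Bool → ℝ) :
    tossMean p n f =
      ∑ x : Fin n → Bool, (∏ i, if x i = true then p else 1 - p) * f (List.ofFn x) := by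
  induction n generalizing f with
  | zero => simp [tossMean]
  | succ n ih =>
    rw [tossMean, ih, ih, ← (Fin.consEquiv fun _ => Bool).sum_comp, Fintype.sum_prod_type,
      Fintype.sum_bool, Finset.mul_sum, Finset.mul_sum]
    congr 1 <;> refine Finset.sum_congr rfl fun x _ => ?_ <;>
      simp [Fin.consEquiv, Fin.prod_univ_succ, List.ofFn_succ, mul_assoc]

theorem IsCoinTossing.measureReal_eq_prod {Ω : Type*} [MeasurableSpace Ω] {P : Measure Ω}
    {p : ℝ} {N : ℕ} {X : Fin N → Ω → Bool} (h : IsCoinTossing P p X) (x : Fin N → Bool) :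
    P.real ((fun ω i => X i ω) ⁻¹' {x}) = ∏ i, if x i = true then p else 1 - p := by
  have h1 : ((fun ω i => X i ω) ⁻¹' {x}) = ⋂ i ∈ (Finset.univ : Finset (Fin N)), X i ⁻¹' {x i} := by
    ext ω
    simp [funext_iff]
  rw [h1, Measure.real, h.indep.measure_inter_preimage_eq_mul Finset.univ
    (fun i _ => measurableSet_singleton _), ENNReal.toReal_prod]
  refine Finset.prod_congr rfl fun i _ => ?_
  split_ifs with hi
  · rw [hi]; exact h.prob_heads i
  · rw [Bool.not_eq_true] at hi
    rw [hi]; exact h.prob_tails i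

/-- The law of the tosses does not depend on the probability space. -/
theorem IsCoinTossing.measureReal_eq_tossProb {Ω : Type*} [MeasurableSpace Ω] {P : Measure Ω}
    [IsProbabilityMeasure P] {p : ℝ} {N : ℕ} {X : Fin N → Ω → Bool} (h : IsCoinTossing P p X)
    (Q : (Fin N → Bool) → Prop) :
    P.real {ω | Q (fun i => X i ω)} =
      tossProb p N (fun l => ∃ x : Fin N → Bool, List.ofFn x = l ∧ Q x) := by
  classical
  have hm : Measurable fun ω i => X i ω := measurable_pi_lambda _ h.measurable
  have h1 : {ω | Q (fun i => X i ω)} =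
      (fun ω i => X i ω) ⁻¹' ((Finset.univ.filter Q : Finset (Fin N → Bool)) : Set _) := by
    ext ω
    simp
  rw [h1, ← sum_measureReal_preimage_singleton _ fun x _ => hm (measurableSet_singleton x),
    Finset.sum_filter, tossProb, tossMean_eq_sum]
  refine Finset.sum_congr rfl fun x _ => ?_
  rw [h.measureReal_eq_prod]
  simp [List.ofFn_injective.eq_iff]

/-! ### Longest run versus absence of bad windows. -/

theorem count_take_drop_ofFn {N : ℕ} (x : Fin N → Bool) {n m : ℕ} (h : n + m ≤ N) :
    (((List.ofFn x).drop n).take m).count false = (Finset.univ.filter (fun i : Fin N =>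
      n ≤ (i : ℕ) ∧ (i : ℕ) < n + m ∧ x i = false)).card := by
  induction m with
  | zero =>
    symm
    simp only [List.take_zero, List.count_nil, Finset.card_eq_zero]
    ext i
    simp
    omega
  | succ m ih =>
    have h1 : (Finset.univ.filter (fun i : Fin N =>
        n ≤ (i : ℕ) ∧ (i : ℕ) < n + (m + 1) ∧ x i = false)) =
        (Finset.univ.filter (fun i : Fin N =>
          n ≤ (i : ℕ) ∧ (i : ℕ) < n + m ∧ x i = false)) ∪
        (Finset.univ.filter (fun i : Fin N => i = ⟨n + m, by omega⟩ ∧ x i = false)) := by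
      ext i
      simp only [Finset.mem_filter, Finset.mem_univ, true_and, Finset.mem_union, Fin.ext_iff]
      constructor
      · rintro ⟨h1, h2, h3⟩
        rcases lt_or_ge (i : ℕ) (n + m) with h4 | h4
        · exact Or.inl ⟨h1, h4, h3⟩
        · exact Or.inr ⟨by omega, h3⟩
      · rintro (⟨h1, h2, h3⟩ | ⟨h1, h2⟩)
        · exact ⟨h1, by omega, h3⟩
        · exact ⟨by omega, by omega, h2⟩
    rw [h1, Finset.card_union_of_disjoint, ← ih (by omega), List.take_add_one, List.count_append]
    · congr 1
      rw [List.getElem?_drop, List.getElem?_eq_getElem (by simp; omega)]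
      simp only [List.getElem_ofFn, Option.toList_some, List.count_singleton]
      by_cases hx : x ⟨n + m, by omega⟩ = false
      · rw [Finset.card_eq_one.2 ⟨⟨n + m, by omega⟩, ?_⟩]
        · simp [hx]
        · ext i
          simp only [Finset.mem_filter, Finset.mem_univ, true_and, Finset.mem_singleton]
          exact ⟨And.left, fun hi => ⟨hi, hi ▸ hx⟩⟩
      · rw [Finset.card_eq_zero.2]
        · simpa using hx
        · ext i
          simp only [Finset.mem_filter, Finset.mem_univ, true_and, Finset.notMem_empty, iff_false]
          rintro ⟨rfl, hi⟩
          exact hx hi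
    · rw [Finset.disjoint_left]
      intro i hi hi'
      simp only [Finset.mem_filter, Finset.mem_univ, true_and, Fin.ext_iff] at hi hi'
      omega

/-- A window with at most `T` tails can be enlarged to a window with exactly `T` tails. -/
theorem exists_window_count_eq {T : ℕ} {l : List Bool} (hl : T ≤ l.count false) {n m : ℕ}
    (h : n + m ≤ l.length) (hT : ((l.drop n).take m).count false ≤ T) :
    ∃ n' m', m ≤ m' ∧ n' + m' ≤ l.length ∧ ((l.drop n').take m').count false = T := by
  rcases hT.eq_or_lt with hT | hT
  · exact ⟨n, m, le_rfl, h, hT⟩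
  rcases h.lt_or_eq with h' | h'
  · obtain ⟨n', m', h1, h2⟩ := exists_window_count_eq hl (n := n) (m := m + 1) (by omega) (by
      rw [List.take_add_one, List.count_append, List.getElem?_drop, List.getElem?_eq_getElem h']
      have := List.count_le_length (a := false) (l := (some l[n + m]).toList)
      simp only [Option.toList_some, List.length_singleton] at this ⊢
      omega)
    exact ⟨n', m', by omega, h2⟩
  -- The window touches the right end, so it is enlarged to the left; if it is already the whole
  -- list, its deficit of tails contradicts `hl`.
  · cases n with
    | zero =>
      rw [List.drop_zero, List.take_of_length_le (by omega)] at hT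
      omega
    | succ n =>
      obtain ⟨n', m', h1, h2⟩ := exists_window_count_eq hl (n := n) (m := m + 1) (by omega) (by
        rw [List.drop_eq_getElem_cons (by omega), List.take_succ_cons, List.count_cons]
        split_ifs <;> omega)
      exact ⟨n', m', by omega, h2⟩
termination_by l.length - m

theorem longestRun_lt_of_runFree {T m N : ℕ} (hm : 0 < m) {x : Fin N → Bool}
    (h : RunFree T m (List.ofFn x)) : longestRun T x < m := by
  by_contra! hlt
  have hne : {m : ℕ | ∃ n : ℕ, IsContaminatedRun T x n m}.Nonempty := by
    rw [Set.nonempty_iff_ne_empty]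
    intro he
    -- Without any run the supremum takes its default value 0, which is below m.
    rw [longestRun, he, csSup_empty] at hlt
    exact hm.not_ge hlt
  obtain ⟨n, h1, h2⟩ := Nat.sSup_mem hne (bddAbove_contaminatedRun T x)
  change n + longestRun T x ≤ N at h1
  change (Finset.univ.filter (fun i : Fin N =>
    n ≤ (i : ℕ) ∧ (i : ℕ) < n + longestRun T x ∧ x i = false)).card = T at h2
  rw [← count_take_drop_ofFn x h1] at h2
  have h3 := h n (by simp; omega)
  have h4 := (List.take_sublist_take_left (l := (List.ofFn x).drop n) hlt).count_le false
  omega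

theorem runFree_or_count_lt_of_longestRun_lt {T m N : ℕ} {x : Fin N → Bool}
    (h : longestRun T x < m) : RunFree T m (List.ofFn x) ∨ (List.ofFn x).count false < T := by
  by_contra! hx
  obtain ⟨h1, h2⟩ := hx
  simp only [RunFree, not_forall, not_lt] at h1
  obtain ⟨s, hs, hT⟩ := h1
  obtain ⟨n', m', h3, h4, h5⟩ := exists_window_count_eq h2 hs hT
  rw [List.length_ofFn] at h4
  rw [count_take_drop_ofFn x h4] at h5
  have := le_csSup (bddAbove_contaminatedRun T x) ⟨n', h4, h5⟩
  change m' ≤ longestRun T x at this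
  omega

/-- The two events differ only when there are fewer than T tails in all, and then the first window
is bad. -/
theorem abs_tossProb_longestRun_lt_sub_le {p : ℝ} (hp0 : 0 ≤ p) (hp1 : p ≤ 1) {T m N : ℕ}
    (hm : 0 < m) (hN : m ≤ N) :
    |tossProb p N (fun l => ∃ x : Fin N → Bool, List.ofFn x = l ∧ longestRun T x < m) -
        tossProb p N (RunFree T m)| ≤ tossProb p m (fun l => l.count false ≤ T) := by
  have h1 : tossProb p N (RunFree T m) ≤
      tossProb p N (fun l => ∃ x : Fin N → Bool, List.ofFn x = l ∧ longestRun T x < m) := by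
    refine tossProb_mono hp0 hp1 fun l hl h => ?_
    subst hl
    exact ⟨l.get, List.ofFn_get l, longestRun_lt_of_runFree hm (by rwa [List.ofFn_get])⟩
  have h2 : tossProb p N (fun l => ∃ x : Fin N → Bool, List.ofFn x = l ∧ longestRun T x < m) ≤
      tossProb p N (RunFree T m) + tossProb p N (fun l => (l.take m).count false ≤ T) := by
    refine (tossProb_mono hp0 hp1 fun l hl h => ?_).trans (tossProb_or_le hp0 hp1 _ _ _)
    obtain ⟨x, rfl, hx⟩ := h
    refine (runFree_or_count_lt_of_longestRun_lt hx).imp id fun hc => ?_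
    exact ((List.take_sublist m _).count_le false).trans hc.le
  have h3 := tossProb_take p m (N - m) (fun l => l.count false ≤ T)
  rw [Nat.add_sub_cancel' hN] at h3
  rw [h3] at h2
  rw [abs_of_nonneg (by linarith)]
  linarith

/-! ### Bounded functions and Taylor remainders. -/

section Bounded

variable {α : Type*} {l : Filter α} {f g : α → ℝ}

theorem isBigO_one_const (a : ℝ) : (fun _ : α => a) =O[l] fun _ => (1 : ℝ) :=
  isBigO_const_const a one_ne_zero l

theorem isBigO_one_add (hf : f =O[l] fun _ => (1 : ℝ)) (hg : g =O[l] fun _ => (1 : ℝ)) :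
    (fun n => f n + g n) =O[l] fun _ => (1 : ℝ) := hf.add hg

theorem isBigO_one_sub (hf : f =O[l] fun _ => (1 : ℝ)) (hg : g =O[l] fun _ => (1 : ℝ)) :
    (fun n => f n - g n) =O[l] fun _ => (1 : ℝ) := hf.sub hg

theorem isBigO_one_mul (hf : f =O[l] fun _ => (1 : ℝ)) (hg : g =O[l] fun _ => (1 : ℝ)) :
    (fun n => f n * g n) =O[l] fun _ => (1 : ℝ) := by
  simpa using hf.mul hg

theorem isBigO_one_exp (hf : f =O[l] fun _ => (1 : ℝ)) :
    (fun n => Real.exp (f n)) =O[l] fun _ => (1 : ℝ) := by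
  obtain ⟨C, hC⟩ := hf.bound
  refine IsBigO.of_bound (Real.exp C) (hC.mono fun n hn => ?_)
  simp only [norm_one, mul_one, Real.norm_eq_abs, Real.abs_exp, Real.exp_le_exp] at hn ⊢
  exact (le_abs_self _).trans hn

theorem isBigO_mul_of_isBigO_one {h : α → ℝ} (hf : f =O[l] h) (hg : g =O[l] fun _ => (1 : ℝ)) :
    (fun n => f n * g n) =O[l] h := by
  simpa using hf.mul hg

theorem isBigO_exp_sub_one (hf : Tendsto f l (nhds 0)) :
    (fun n => Real.exp (f n) - 1) =O[l] f := by
  refine IsBigO.of_bound 2 ?_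
  have := hf.abs.eventually (eventually_le_nhds (show |(0 : ℝ)| < 1 by simp))
  exact this.mono fun n hn => Real.abs_exp_sub_one_le hn

/-- Second order is needed: f will be of size log L / L, whose cube, but not whose square, is
O(L⁻²). -/
theorem isBigO_log_one_add (hf : Tendsto f l (nhds 0)) :
    (fun n => Real.log (1 + f n) - f n + f n ^ 2 / 2) =O[l] fun n => f n ^ 3 := by
  refine IsBigO.of_bound 2 ?_
  have := hf.abs.eventually (eventually_le_nhds (show |(0 : ℝ)| < 1 / 2 by simp))
  refine this.mono fun n hn => ?_
  have h := Real.abs_log_sub_add_sum_range_le (x := -f n) (by rw [abs_neg]; linarith) 2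
  simp only [Finset.sum_range_succ, Finset.sum_range_zero, abs_neg] at h
  rw [Real.norm_eq_abs, Real.norm_eq_abs, abs_pow]
  refine (le_of_eq ?_).trans (h.trans ?_)
  · congr 1
    push_cast
    ring_nf
  · rw [div_le_iff₀ (by linarith)]
    have := pow_nonneg (abs_nonneg (f n)) 3
    norm_num
    nlinarith

theorem isBigO_inv_one_add (hf : Tendsto f l (nhds 0)) :
    (fun n => (1 + f n)⁻¹ - 1 + f n) =O[l] fun n => f n ^ 2 := by
  refine IsBigO.of_bound 2 ?_
  have := hf.abs.eventually (eventually_le_nhds (show |(0 : ℝ)| < 1 / 2 by simp))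
  refine this.mono fun n hn => ?_
  have h1 : 1 / 2 ≤ 1 + f n := by linarith [neg_abs_le (f n)]
  have h2 : (1 + f n)⁻¹ - 1 + f n = f n ^ 2 * (1 + f n)⁻¹ := by
    field_simp
    ring
  have h3 : (1 + f n)⁻¹ ≤ 2 := by
    rw [inv_le_comm₀ (by linarith) (by norm_num)]
    linarith
  rw [h2, norm_mul, mul_comm]
  refine mul_le_mul_of_nonneg_right ?_ (norm_nonneg _)
  rwa [Real.norm_eq_abs, abs_of_pos (by positivity)]

end Bounded

/-! ### The centering as an approximate solution of the clump equation. -/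

/-- The correction terms of the centering, in terms of `w = 1 / L` and `y = log L / L`. -/
noncomputable def centeringCorrection (T c q₀ A w y : ℝ) : ℝ :=
  T ^ 2 * y / c - T * w / (c * q₀) - T ^ 3 / (2 * c) * y ^ 2 + T ^ 2 * y * w / (c * q₀)
    + T ^ 3 * y * w / c ^ 2 + A * (T * w / c - T ^ 2 * y * w / c)

section Centering

variable {α : Type*} {l : Filter α} {L x : α → ℝ} (T c q₀ A : ℝ)

theorem tendsto_log_pow_div_atTop (hL : Tendsto L l atTop) (k : ℕ) :
    Tendsto (fun n => Real.log (L n) ^ k / L n) l (nhds 0) :=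
  (Real.isLittleO_pow_log_id_atTop (n := k)).tendsto_div_nhds_zero.comp hL

/-- The relative deviation of the centering (shifted by `x`) from its main term. -/
noncomputable def centeringRelDev (w y x : ℝ) : ℝ :=
  T * y + (A + x) * w + centeringCorrection T c q₀ A w y * w

variable {T c q₀ A}

theorem isBigO_one_centeringCorrection {w y : α → ℝ} (hw : w =O[l] fun _ => (1 : ℝ))
    (hy : y =O[l] fun _ => (1 : ℝ)) :
    (fun n => centeringCorrection T c q₀ A (w n) (y n)) =O[l] fun _ => (1 : ℝ) := by
  simp only [centeringCorrection, div_eq_mul_inv]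
  repeat' first
    | exact isBigO_one_const _
    | exact hw
    | exact hy
    | apply isBigO_one_sub
    | apply isBigO_one_add
    | apply isBigO_one_mul

theorem isBigO_centeringRelDev {w y : α → ℝ} (hw : w =O[l] fun _ => (1 : ℝ))
    (hy : y =O[l] fun _ => (1 : ℝ)) (hx : x =O[l] fun _ => (1 : ℝ)) (hwy : w =O[l] y) :
    (fun n => centeringRelDev T c q₀ A (w n) (y n) (x n)) =O[l] y := by
  have hd := isBigO_one_centeringCorrection (T := T) (c := c) (q₀ := q₀) (A := A) hw hy
  refine (IsBigO.add ((isBigO_refl y l).const_mul_left T) ?_).add ?_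
  · simpa [mul_comm] using isBigO_mul_of_isBigO_one hwy ((isBigO_one_const A).add hx)
  · simpa [mul_comm] using isBigO_mul_of_isBigO_one hwy hd

/-- This is the clump equation with logarithm and inverse replaced by their Taylor polynomials. The
coefficients of the centering make all terms in y, w, y² and yw cancel; what remains is divisible by
w² or y²w, with the bounded cofactors displayed in `h1` and `h2`. -/
theorem isBigO_centering_polynomial {w y : α → ℝ} (hw : w =O[l] fun _ => (1 : ℝ))
    (hy : y =O[l] fun _ => (1 : ℝ)) (hx : x =O[l] fun _ => (1 : ℝ))
    (hyw : (fun n => y n ^ 2 * w n) =O[l] fun n => w n ^ 2) :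
    (fun n => centeringCorrection T c q₀ A (w n) (y n)
      + x n * (T * w n / c - T ^ 2 * y n * w n / c)
      - T / c * (centeringRelDev T c q₀ A (w n) (y n) (x n)
          - centeringRelDev T c q₀ A (w n) (y n) (x n) ^ 2 / 2)
      + T / (c * q₀) * w n * (1 - centeringRelDev T c q₀ A (w n) (y n) (x n)))
      =O[l] fun n => w n ^ 2 := by
  have hd := isBigO_one_centeringCorrection (T := T) (c := c) (q₀ := q₀) (A := A) hw hy
  set D := fun n => centeringCorrection T c q₀ A (w n) (y n) with hD
  have h1 : (fun n => T / c / 2 * (A + x n) ^ 2 + T ^ 2 / c ^ 2 * (1 / q₀ - A)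
      - T / (c * q₀) * (A + x n)
      - T / c * ((T ^ 2 / (c * q₀) + T ^ 3 / c ^ 2 - A * T ^ 2 / c) * y n)
      + T / c * (T * y n * (-(T / (c * q₀)) + T ^ 2 / (c * q₀) * y n + T ^ 3 / c ^ 2 * y n
        + A * (T / c - T ^ 2 / c * y n)) + (A + x n) * D n)
      + T / c / 2 * D n ^ 2 - T / (c * q₀) * D n) =O[l] fun _ => (1 : ℝ) := by
    repeat' first
      | exact isBigO_one_const _
      | exact hw
      | exact hy
      | exact hx
      | exact hd
      | apply isBigO_one_sub
      | apply isBigO_one_add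
      | apply isBigO_one_mul
  have h2 : (fun n => T / c * (T ^ 3 / (2 * c)) + T ^ 2 / c * (T ^ 2 / c - T ^ 3 / (2 * c) * y n))
      =O[l] fun _ => (1 : ℝ) := by
    repeat' first
      | exact isBigO_one_const _
      | exact hy
      | apply isBigO_one_sub
      | apply isBigO_one_add
      | apply isBigO_one_mul
  refine ((isBigO_mul_of_isBigO_one (isBigO_refl _ _) h1).add
    (isBigO_mul_of_isBigO_one hyw h2)).congr_left fun n => ?_
  simp only [hD, centeringRelDev, centeringCorrection]
  ring

/-- With w = 1/L and y = log L / L, the orders of y²w and y³ follow from log^k L / L → 0 for k = 2,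
3. -/
theorem centering_facts (hc : 0 < c) (hL : Tendsto L l atTop) (hx : x =O[l] fun _ => (1 : ℝ)) :
    (fun n => (L n)⁻¹) =O[l] (fun _ => (1 : ℝ)) ∧
    (fun n => Real.log (L n) / c / L n) =O[l] (fun _ => (1 : ℝ)) ∧
    ((fun n => (Real.log (L n) / c / L n) ^ 2 * (L n)⁻¹) =O[l] fun n => (L n)⁻¹ ^ 2) ∧
    ((fun n => (Real.log (L n) / c / L n) ^ 3) =O[l] fun n => (L n)⁻¹ ^ 2) ∧
    ((fun n => centeringRelDev T c q₀ A (L n)⁻¹ (Real.log (L n) / c / L n) (x n)) =O[l]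
      fun n => Real.log (L n) / c / L n) ∧
    Tendsto (fun n => centeringRelDev T c q₀ A (L n)⁻¹ (Real.log (L n) / c / L n) (x n)) l
      (nhds 0) := by
  have hw0 : Tendsto (fun n => (L n)⁻¹) l (nhds 0) := tendsto_inv_atTop_zero.comp hL
  have hw : (fun n => (L n)⁻¹) =O[l] (fun _ => (1 : ℝ)) := hw0.isBigO_one ℝ
  have hy0 : Tendsto (fun n => Real.log (L n) / c / L n) l (nhds 0) := by
    simpa [div_right_comm] using (tendsto_log_pow_div_atTop hL 1).div_const c
  have hy : (fun n => Real.log (L n) / c / L n) =O[l] (fun _ => (1 : ℝ)) := hy0.isBigO_one ℝ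
  have hwy : (fun n => (L n)⁻¹) =O[l] fun n => Real.log (L n) / c / L n := by
    refine IsBigO.of_bound 1 ?_
    filter_upwards [(Real.tendsto_log_atTop.comp hL).eventually_ge_atTop c,
      hL.eventually_gt_atTop 0] with n h1 h2
    change c ≤ Real.log (L n) at h1
    rw [one_mul, Real.norm_of_nonneg (by positivity), div_eq_mul_inv _ (L n), norm_mul,
      Real.norm_of_nonneg (r := (L n)⁻¹) (by positivity)]
    refine le_mul_of_one_le_left (by positivity) ?_
    rw [Real.norm_of_nonneg (div_nonneg (hc.le.trans h1) hc.le), le_div_iff₀ hc, one_mul]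
    exact h1
  have hu := isBigO_centeringRelDev (T := T) (c := c) (q₀ := q₀) (A := A) hw hy hx hwy
  refine ⟨hw, hy, ?_, ?_, hu, hu.trans_tendsto hy0⟩
  · refine ((isBigO_mul_of_isBigO_one (isBigO_refl (fun n => (L n)⁻¹ ^ 2) l)
      (((tendsto_log_pow_div_atTop hL 2).isBigO_one ℝ).const_mul_left (1 / c ^ 2)))).congr_left
      fun n => ?_
    simp only [div_eq_mul_inv]
    ring
  · refine ((isBigO_mul_of_isBigO_one (isBigO_refl (fun n => (L n)⁻¹ ^ 2) l)
      (((tendsto_log_pow_div_atTop hL 3).isBigO_one ℝ).const_mul_left (1 / c ^ 3)))).congr_left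
      fun n => ?_
    simp only [div_eq_mul_inv]
    ring

theorem tendsto_centering_div (hc : 0 < c) (hL : Tendsto L l atTop)
    (hx : x =O[l] fun _ => (1 : ℝ)) :
    Tendsto (fun n => (L n + T * (Real.log (L n) / c) + A + x n
      + centeringCorrection T c q₀ A (L n)⁻¹ (Real.log (L n) / c / L n)) / L n) l (nhds 1) := by
  have hu := (centering_facts (T := T) (q₀ := q₀) (A := A) hc hL hx).2.2.2.2.2
  have := hu.const_add 1
  rw [add_zero] at this
  refine this.congr' ?_
  filter_upwards [hL.eventually_gt_atTop 0] with n hn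
  simp only [centeringRelDev]
  field_simp
  ring

/-- The centering solves, up to a second order error, the equation that makes the expected number
of clumps of runs equal to a prescribed value. -/
theorem isBigO_centering_equation (hc : 0 < c) (hL : Tendsto L l atTop)
    (hx : x =O[l] fun _ => (1 : ℝ)) {M : α → ℝ}
    (hM : ∀ᶠ n in l, M n = L n + T * (Real.log (L n) / c) + A + x n
      + centeringCorrection T c q₀ A (L n)⁻¹ (Real.log (L n) / c / L n)) :
    (fun n => M n - T * (Real.log (M n) / c) + T / (c * q₀ * M n) - L n - A
      - x n * (1 - T / (c * L n) + T ^ 2 * (Real.log (L n) / c / (c * L n ^ 2))))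
      =O[l] fun n => (L n)⁻¹ ^ 2 := by
  obtain ⟨hw, hy, hyw, hy3, huy, hu⟩ := centering_facts (T := T) (q₀ := q₀) (A := A) hc hL hx
  have h1 := isBigO_centering_polynomial (T := T) (c := c) (q₀ := q₀) (A := A) hw hy hx hyw
  have h2 := ((isBigO_log_one_add hu).trans ((huy.pow 3).trans hy3)).const_mul_left (T / c)
  have h3 : (fun n => ((1 + centeringRelDev T c q₀ A (L n)⁻¹ (Real.log (L n) / c / L n) (x n))⁻¹
      - 1 + centeringRelDev T c q₀ A (L n)⁻¹ (Real.log (L n) / c / L n) (x n)) * (L n)⁻¹)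
      =O[l] fun n => (L n)⁻¹ ^ 2 :=
    (((isBigO_inv_one_add hu).trans (huy.pow 2)).mul (isBigO_refl (fun n => (L n)⁻¹) l)).trans hyw
  refine ((h1.sub h2).add (h3.const_mul_left (T / (c * q₀)))).congr' ?_ .rfl
  filter_upwards [hM, hL.eventually_gt_atTop 0,
    hu.eventually (lt_mem_nhds (show (-1 : ℝ) < 0 by norm_num))] with n hn hL0 hu1
  -- Writing M = L(1 + u) separates log M and 1/M into their values at L and Taylor remainders in u
  -- = O(y).
  have hMu : M n =
      L n * (1 + centeringRelDev T c q₀ A (L n)⁻¹ (Real.log (L n) / c / L n) (x n)) := by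
    rw [hn]
    simp only [centeringRelDev]
    field_simp
    ring
  have hlog : Real.log (M n) = Real.log (L n) + Real.log
      (1 + centeringRelDev T c q₀ A (L n)⁻¹ (Real.log (L n) / c / L n) (x n)) := by
    rw [hMu, Real.log_mul hL0.ne' (by linarith)]
  have hinv : T / (c * q₀ * M n) = T / (c * q₀) * (L n)⁻¹ *
      (1 + centeringRelDev T c q₀ A (L n)⁻¹ (Real.log (L n) / c / L n) (x n))⁻¹ := by
    rw [hMu]
    simp only [div_eq_mul_inv, mul_inv]
    ring
  rw [hlog, hinv, hn]
  generalize centeringRelDev T c q₀ A (L n)⁻¹ (Real.log (L n) / c / L n) (x n) = u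
  generalize centeringCorrection T c q₀ A (L n)⁻¹ (Real.log (L n) / c / L n) = D
  simp only [div_eq_mul_inv, mul_inv]
  ring

end Centering

/-! ### Asymptotics of the clump probability. -/

section ClumpRate

variable {p : ℝ}

/-- The probability that a clump of runs of length `m` starts at a given toss, up to a relative
error of order `1 / m ^ 2`. -/
noncomputable def clumpRate (T : ℕ) (p : ℝ) (m : ℕ) : ℝ :=
  (1 - p) * ((1 - p) / p) ^ T / T.factorial * p ^ m * m ^ T

theorem isBigO_tossProb_runOnlyAtStart_one (hp0 : 0 < p) (hp1 : p < 1) :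
    (fun m : ℕ => tossProb p (2 * m) (RunOnlyAtStart 1 m)
      - clumpRate 1 p m * (1 - (1 : ℕ) / (qZero 1 p * m))) =O[atTop]
      fun m : ℕ => clumpRate 1 p m / m ^ 2 := by
  refine IsBigO.of_bound (1 / (1 - p)) ?_
  have hq : 0 < 1 - p := by linarith
  filter_upwards [(tendsto_self_mul_const_pow_of_lt_one hp0.le hp1).eventually
    (ge_mem_nhds zero_lt_one), eventually_gt_atTop 0] with m hm hm0
  obtain ⟨n, rfl⟩ := Nat.exists_eq_succ_of_ne_zero hm0.ne'
  have h := mul_leadProb_one_zero p n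
  have hn : (0 : ℝ) < n + 1 := by positivity
  have h1 : tossProb p (2 * (n + 1)) (RunOnlyAtStart 1 (n + 1))
      - clumpRate 1 p (n + 1) * (1 - (1 : ℕ) / (qZero 1 p * (n + 1 : ℕ))) =
      (1 - p) * p ^ n * p ^ (n + 1) := by
    rw [tossProb_runOnlyAtStart_two_mul]
    have : qZero 1 p = 1 - p := by simp [qZero]
    rw [this]
    simp only [clumpRate, Nat.factorial_one]
    push_cast
    have h2 : (1 - p) * ((1 - p) / p) ^ 1 / 1 * p ^ (n + 1) * (n + 1 : ℝ) ^ 1 *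
        (1 - 1 / ((1 - p) * (n + 1))) = (1 - p) * p ^ n * ((1 - p) * (n + 1) - 1) := by
      field_simp
      ring
    rw [h2]
    linear_combination (1 - p) * h
  have h2 : clumpRate 1 p (n + 1) / ((n + 1 : ℕ) : ℝ) ^ 2 =
      (1 - p) ^ 2 * p ^ n / (n + 1) := by
    simp only [clumpRate, Nat.factorial_one]
    push_cast
    field_simp
    ring
  rw [Nat.succ_eq_add_one, h1, h2, Real.norm_of_nonneg (by positivity),
    Real.norm_of_nonneg (by positivity)]
  have h3 : 1 / (1 - p) * ((1 - p) ^ 2 * p ^ n / (n + 1)) = (1 - p) * p ^ n * (1 / (n + 1)) := by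
    field_simp
  rw [h3]
  refine mul_le_mul_of_nonneg_left ?_ (by positivity)
  rw [le_div_iff₀ hn]
  rw [Nat.succ_eq_add_one] at hm
  push_cast at hm
  linarith

theorem isBigO_tossProb_runOnlyAtStart_two (hp0 : 0 < p) (hp1 : p < 1) :
    (fun m : ℕ => tossProb p (2 * m) (RunOnlyAtStart 2 m)
      - clumpRate 2 p m * (1 - (2 : ℕ) / (qZero 2 p * m))) =O[atTop]
      fun m : ℕ => clumpRate 2 p m / m ^ 2 := by
  have hq : 0 < 1 - p := by linarith
  refine IsBigO.of_bound ((2 + 2 * p / (1 - p)) + 6 * p / (1 - p) ^ 2) ?_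
  filter_upwards [eventually_gt_atTop 0] with m hm0
  obtain ⟨n, rfl⟩ := Nat.exists_eq_succ_of_ne_zero hm0.ne'
  have hb := leadProb_two_zero_bounds hp0.le hp1.le n
  have h := sq_mul_tossProb_count_eq_two p n
  have hn : (0 : ℝ) < n + 1 := by positivity
  have hqz : qZero 2 p = 2 * (1 - p) / (2 + (1 - p)) := by
    rw [qZero]; congr 1; push_cast; ring
  have hq2 : 0 < 2 + (1 - p) := by linarith
  -- With m = n + 1 and q = 1 - p, n(n-1) - 2pn/q = m² - (2/q₀)m + (2 + 2p/q): the linear term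
  -- explains q₀, the last one is the explicit error.
  have h1 : tossProb p (2 * (n + 1)) (RunOnlyAtStart 2 (n + 1))
      - clumpRate 2 p (n + 1) * (1 - (2 : ℕ) / (qZero 2 p * (n + 1 : ℕ))) =
      (1 - p) ^ 3 / (2 * p ^ 2) * p ^ (n + 1) * (2 + 2 * p / (1 - p)) -
        (1 - p) * (p * (tossProb p n (fun l => l.count false = 2) - leadProb p n 2 0)
          - n * (1 - p) * p ^ n) := by
    rw [tossProb_runOnlyAtStart_two_mul, hqz]
    generalize leadProb p n 2 0 = H at *
    have h2 : tossProb p n (fun l => l.count false = 2) =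
        n * (n - 1) / 2 * (1 - p) ^ 2 * p ^ n / p ^ 2 := by
      rw [← h]; field_simp
    rw [h2]
    simp only [clumpRate, Nat.factorial_two]
    push_cast
    field_simp
    ring
  have h2 : clumpRate 2 p (n + 1) / ((n + 1 : ℕ) : ℝ) ^ 2 =
      (1 - p) ^ 3 / (2 * p ^ 2) * p ^ (n + 1) := by
    simp only [clumpRate, Nat.factorial_two]
    push_cast
    field_simp
  rw [Nat.succ_eq_add_one, h1, h2,
    Real.norm_of_nonneg (r := (1 - p) ^ 3 / (2 * p ^ 2) * p ^ (n + 1)) (by positivity)]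
  refine (norm_sub_le _ _).trans ?_
  rw [Real.norm_of_nonneg (by positivity), norm_mul, Real.norm_of_nonneg hq.le, Real.norm_eq_abs]
  calc _ ≤ (1 - p) ^ 3 / (2 * p ^ 2) * p ^ (n + 1) * (2 + 2 * p / (1 - p)) +
        (1 - p) * (3 * p ^ n) := by gcongr
    _ = _ := by field_simp; ring

/-- Replacing 1 - t by exp(-t) costs O(1/m²) and makes the logarithm of the main term exact. -/
theorem isBigO_tossProb_runOnlyAtStart {T : ℕ} (hT : T = 1 ∨ T = 2) (hp0 : 0 < p) (hp1 : p < 1) :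
    (fun m : ℕ => tossProb p (2 * m) (RunOnlyAtStart T m)
      - clumpRate T p m * Real.exp (-(T / (qZero T p * m)))) =O[atTop]
      fun m : ℕ => clumpRate T p m / m ^ 2 := by
  have h1 : (fun m : ℕ => tossProb p (2 * m) (RunOnlyAtStart T m)
      - clumpRate T p m * (1 - T / (qZero T p * m))) =O[atTop]
      fun m : ℕ => clumpRate T p m / m ^ 2 := by
    rcases hT with rfl | rfl
    · exact isBigO_tossProb_runOnlyAtStart_one hp0 hp1
    · exact isBigO_tossProb_runOnlyAtStart_two hp0 hp1
  have h0 : Tendsto (fun m : ℕ => -(T / (qZero T p * m) : ℝ)) atTop (nhds 0) := by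
    have := (tendsto_const_div_atTop_nhds_zero_nat (T / qZero T p)).neg
    simpa [div_div] using this
  have h2 : (fun m : ℕ => Real.exp (-(T / (qZero T p * m) : ℝ)) - 1 - -(T / (qZero T p * m) : ℝ))
      =O[atTop] fun m : ℕ => (-(T / (qZero T p * m) : ℝ)) ^ 2 := by
    refine IsBigO.of_bound 1 ?_
    filter_upwards [h0.abs.eventually (ge_mem_nhds (show |(0 : ℝ)| < 1 by simp))] with m hm
    rw [one_mul, Real.norm_eq_abs, Real.norm_of_nonneg (sq_nonneg _)]
    exact Real.abs_exp_sub_one_sub_id_le hm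
  have h3 : (fun m : ℕ => (-(T / (qZero T p * m) : ℝ)) ^ 2) =O[atTop]
      fun m : ℕ => 1 / (m : ℝ) ^ 2 := by
    refine ((isBigO_refl (fun m : ℕ => 1 / (m : ℝ) ^ 2) atTop).const_mul_left
      ((T / qZero T p) ^ 2)).congr_left fun m => ?_
    simp only [div_eq_mul_inv, mul_inv]
    ring
  have h4 := (isBigO_refl (fun m : ℕ => clumpRate T p m) atTop).mul (h2.trans h3)
  have h5 := h1.sub (h4.congr_right fun m => by ring)
  exact h5.congr_left fun m => by ring

theorem isBigO_tossProb_count_le (hp0 : 0 < p) (hp1 : p < 1) (T : ℕ) :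
    (fun m : ℕ => tossProb p m (fun l => l.count false ≤ T)) =O[atTop] clumpRate T p := by
  have hq : 0 < 1 - p := by linarith
  refine IsBigO.of_bound (2 ^ T / p ^ T / ((1 - p) * ((1 - p) / p) ^ T / T.factorial)) ?_
  filter_upwards [eventually_gt_atTop 0] with m hm
  have h := mul_tossProb_count_le_le hp0.le hp1.le T m
  have hm1 : (1 : ℝ) ≤ m := by exact_mod_cast hm
  rw [Real.norm_of_nonneg (tossProb_nonneg hp0.le hp1.le _ _), Real.norm_of_nonneg
    (by unfold clumpRate; positivity), clumpRate]
  have h1 : (m + 1 : ℝ) ^ T * p ^ m ≤ (2 * m) ^ T * p ^ m := by gcongr; linarith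
  have h2 : (0 : ℝ) < T.factorial := by positivity
  calc _ = p ^ T * tossProb p m (fun l => l.count false ≤ T) / p ^ T := by field_simp
    _ ≤ (2 * m) ^ T * p ^ m / p ^ T := by
      gcongr ?_ / _
      exact h.trans h1
    _ = _ := by
      rw [mul_pow]
      field_simp

end ClumpRate

/-! ### Growth of log(qN) and the logarithm of the expected number of clumps. -/

theorem logqN_eq (p : ℝ) (N : ℕ) : logqN p N = Real.log ((1 - p) * N) / Real.log (1 / p) := rfl

theorem loglogqN_eq (p : ℝ) (N : ℕ) :
    loglogqN p N = Real.log (logqN p N) / Real.log (1 / p) := rfl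

theorem centering_eq (T : ℕ) (p : ℝ) (N : ℕ) :
    centering T p N = logqN p N + T * (Real.log (logqN p N) / Real.log (1 / p))
      + (T * Real.logb (1 / p) ((1 - p) / p) - Real.logb (1 / p) (T.factorial : ℝ))
      + centeringCorrection T (Real.log (1 / p)) (qZero T p)
        (T * Real.logb (1 / p) ((1 - p) / p) - Real.logb (1 / p) (T.factorial : ℝ))
        (logqN p N)⁻¹ (Real.log (logqN p N) / Real.log (1 / p) / logqN p N) := by
  simp only [centering, loglogqN_eq, centeringCorrection, div_eq_mul_inv, mul_inv, mul_pow, inv_pow]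
  ring

theorem tendsto_one_sub_mul_atTop {p : ℝ} (hp1 : p < 1) :
    Tendsto (fun N : ℕ => (1 - p) * (N : ℝ)) atTop atTop :=
  tendsto_natCast_atTop_atTop.const_mul_atTop (by linarith)

theorem isLittleO_logqN_pow {p : ℝ} (hp1 : p < 1) (k : ℕ) :
    (fun N : ℕ => logqN p N ^ k) =o[atTop] fun N : ℕ => (N : ℝ) := by
  have h1 := (Real.isLittleO_pow_log_id_atTop (n := k)).comp_tendsto
    (tendsto_one_sub_mul_atTop hp1)
  have h2 := (h1.const_mul_left ((Real.log (1 / p))⁻¹ ^ k)).trans_isBigO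
    ((isBigO_refl (fun N : ℕ => (N : ℝ)) atTop).const_mul_left (1 - p))
  refine h2.congr_left fun N => ?_
  simp only [Function.comp, logqN_eq, div_eq_mul_inv]
  ring

section Limits

variable {p : ℝ} (hp0 : 0 < p) (hp1 : p < 1)
include hp0 hp1

theorem log_one_div_pos : 0 < Real.log (1 / p) :=
  Real.log_pos (by rw [lt_div_iff₀ hp0]; linarith)

theorem tendsto_logqN_atTop : Tendsto (logqN p) atTop atTop :=
  (Real.tendsto_log_atTop.comp (tendsto_one_sub_mul_atTop hp1)).atTop_div_const
    (log_one_div_pos hp0 hp1)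

theorem isBigO_logqN_inv_sq :
    (fun N : ℕ => (logqN p N)⁻¹ ^ 2) =O[atTop]
      fun N : ℕ => 1 / (Real.logb (1 / p) (N : ℝ)) ^ 2 := by
  have hc := log_one_div_pos hp0 hp1
  have hlog : Tendsto (fun N : ℕ => Real.log (N : ℝ)) atTop atTop :=
    Real.tendsto_log_atTop.comp tendsto_natCast_atTop_atTop
  refine IsBigO.of_bound 4 ?_
  filter_upwards [hlog.eventually_ge_atTop (-2 * Real.log (1 - p)), hlog.eventually_gt_atTop 0,
    eventually_gt_atTop 0] with N h1 h2 h3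
  have h4 : Real.log ((1 - p) * N) = Real.log (1 - p) + Real.log N :=
    Real.log_mul (by linarith) (by positivity)
  have h5 : Real.logb (1 / p) N ≤ 2 * logqN p N := by
    rw [logqN_eq, Real.logb, ← mul_div_assoc]
    gcongr
    linarith
  have h6 : 0 < Real.logb (1 / p) N := div_pos h2 hc
  have h7 : 0 < logqN p N := by linarith
  rw [Real.norm_of_nonneg (by positivity), Real.norm_of_nonneg (by positivity), inv_pow,
    ← mul_div_assoc, mul_one, inv_eq_one_div, div_le_div_iff₀ (by positivity) (by positivity)]
  nlinarith

end Limits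

theorem abs_exp_neg_sub_exp_neg_le {a b : ℝ} (ha : 0 ≤ a) (hb : 0 ≤ b) :
    |Real.exp (-a) - Real.exp (-b)| ≤ |a - b| := by
  wlog h : a ≤ b generalizing a b
  · rw [abs_sub_comm, abs_sub_comm a]
    exact this hb ha (le_of_not_ge h)
  have h1 : Real.exp (-b) ≤ Real.exp (-a) := Real.exp_le_exp.2 (by linarith)
  rw [abs_of_nonneg (by linarith), abs_sub_comm, abs_of_nonneg (by linarith)]
  have h2 : Real.exp (-b) = Real.exp (-a) * Real.exp (-(b - a)) := by
    rw [← Real.exp_add]; congr 1; ring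
  have h3 := Real.add_one_le_exp (-(b - a))
  have h4 : Real.exp (-a) ≤ 1 := Real.exp_le_one_iff.2 (by linarith)
  have h5 := Real.exp_pos (-a)
  rw [h2]
  nlinarith

theorem mul_clumpRate_mul_exp {T : ℕ} {p : ℝ} (hp0 : 0 < p) (hp1 : p < 1) {N m : ℕ} (hN : 0 < N)
    (hm : 0 < m) :
    N * (clumpRate T p m * Real.exp (-(T / (qZero T p * m)))) =
      Real.exp (-Real.log (1 / p) * (m - T * (Real.log m / Real.log (1 / p))
        + T / (Real.log (1 / p) * qZero T p * m) - logqN p N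
        - (T * Real.logb (1 / p) ((1 - p) / p) - Real.logb (1 / p) (T.factorial : ℝ)))) := by
  have hc := log_one_div_pos hp0 hp1
  have hq : 0 < 1 - p := by linarith
  have hm' : (0 : ℝ) < m := by exact_mod_cast hm
  have hN' : (0 : ℝ) < N := by exact_mod_cast hN
  have hpos : 0 < (1 - p) * N * ((1 - p) / p) ^ T / T.factorial * p ^ m * (m : ℝ) ^ T := by
    positivity
  have h1 : N * (clumpRate T p m * Real.exp (-(T / (qZero T p * m)))) =
      Real.exp (Real.log ((1 - p) * N * ((1 - p) / p) ^ T / T.factorial * p ^ m * (m : ℝ) ^ T))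
        * Real.exp (-(T / (qZero T p * m))) := by
    rw [Real.exp_log hpos, clumpRate]
    ring
  have hfac : (0 : ℝ) < T.factorial := by positivity
  rw [h1, ← Real.exp_add, Real.log_mul (by positivity) (by positivity),
    Real.log_mul (by positivity) (by positivity), Real.log_div (by positivity) (by positivity),
    Real.log_mul (by positivity) (by positivity), Real.log_pow, Real.log_pow, Real.log_pow]
  congr 1
  have h2 : Real.log p = -Real.log (1 / p) := by rw [one_div, Real.log_inv, neg_neg]
  have h3 : (T : ℝ) / (Real.log (1 / p) * qZero T p * m) =
      T / (qZero T p * m) / Real.log (1 / p) := by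
    rw [div_div]; congr 1; ring
  simp only [h2, h3, logqN_eq, Real.logb]
  generalize Real.log (1 / p) = c at *
  generalize (T : ℝ) / (qZero T p * m) = t
  field_simp
  ring

/-! ### Run lengths at bounded distance from the centering. -/

section Main

variable {T : ℕ} {p : ℝ} {x : ℕ → ℝ} {M : ℕ → ℕ}
  (hp0 : 0 < p) (hp1 : p < 1) (hx : x =O[atTop] fun _ => (1 : ℝ))
include hp0 hp1 hx

theorem isBigO_one_mul_exponentFactor :
    (fun N => x N * exponentFactor T p N) =O[atTop] fun _ => (1 : ℝ) := by
  have hc := log_one_div_pos hp0 hp1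
  -- The values of q₀ and A are arbitrary, since only the two facts that do not involve them are
  -- kept.
  obtain ⟨hw, hy, -⟩ := centering_facts (T := T) (q₀ := 1) (A := 0) hc
    (tendsto_logqN_atTop hp0 hp1) hx
  have h : (fun N => x N * (1 - T / Real.log (1 / p) * (logqN p N)⁻¹ + T ^ 2 / Real.log (1 / p) *
      ((Real.log (logqN p N) / Real.log (1 / p) / logqN p N) * (logqN p N)⁻¹)))
      =O[atTop] fun _ => (1 : ℝ) := by
    repeat' first
      | exact isBigO_one_const _
      | exact hw
      | exact hy
      | exact hx
      | apply isBigO_one_sub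
      | apply isBigO_one_add
      | apply isBigO_one_mul
  refine h.congr_left fun N => ?_
  simp only [exponentFactor, loglogqN_eq, div_eq_mul_inv, mul_inv]
  ring

theorem isBigO_one_rpow_exponentFactor :
    (fun N => p ^ (x N * exponentFactor T p N)) =O[atTop] fun _ => (1 : ℝ) := by
  refine (isBigO_one_exp ((isBigO_one_mul_exponentFactor (T := T) hp0 hp1 hx).const_mul_left
    (Real.log p))).congr_left fun N => ?_
  rw [Real.rpow_def_of_pos hp0]

theorem tendsto_centering_add_div :
    Tendsto (fun N => (centering T p N + x N) / logqN p N) atTop (nhds 1) := by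
  refine (tendsto_centering_div (T := T) (q₀ := qZero T p)
    (A := T * Real.logb (1 / p) ((1 - p) / p) - Real.logb (1 / p) (T.factorial : ℝ))
    (log_one_div_pos hp0 hp1) (tendsto_logqN_atTop hp0 hp1) hx).congr fun N => ?_
  rw [centering_eq]
  congr 1
  ring

theorem tendsto_centering_add_atTop :
    Tendsto (fun N => centering T p N + x N) atTop atTop := by
  have h := (tendsto_centering_add_div (T := T) hp0 hp1 hx).pos_mul_atTop one_pos
    (tendsto_logqN_atTop hp0 hp1)
  refine h.congr' ?_
  filter_upwards [(tendsto_logqN_atTop hp0 hp1).eventually_gt_atTop 0] with N hN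
  field_simp

variable (hM : ∀ᶠ N in atTop, (M N : ℝ) = centering T p N + x N)
include hM

theorem tendsto_natCast_runLength_atTop : Tendsto (fun N => (M N : ℝ)) atTop atTop :=
  (tendsto_centering_add_atTop hp0 hp1 hx).congr' (hM.mono fun _ h => h.symm)

theorem isBigO_runLength_logqN : (fun N => (M N : ℝ)) =O[atTop] logqN p := by
  refine isBigO_of_div_tendsto_nhds ?_ 1 ?_
  · filter_upwards [(tendsto_logqN_atTop hp0 hp1).eventually_gt_atTop 0] with N hN h0
    exact absurd h0 hN.ne'
  · refine (tendsto_centering_add_div (T := T) hp0 hp1 hx).congr'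
      (hM.mono fun N h => ?_)
    rw [Pi.div_apply, h]

theorem isBigO_runLength_inv_sq :
    (fun N => 1 / (M N : ℝ) ^ 2) =O[atTop] fun N => (logqN p N)⁻¹ ^ 2 := by
  have h : logqN p =O[atTop] fun N => (M N : ℝ) := by
    refine isBigO_of_div_tendsto_nhds ?_ 1 ?_
    · filter_upwards [(tendsto_natCast_runLength_atTop hp0 hp1 hx hM).eventually_gt_atTop 0] with
        N hN h0
      exact absurd h0 hN.ne'
    · have h1 := (tendsto_centering_add_div (T := T) hp0 hp1 hx).inv₀ one_ne_zero
      rw [inv_one] at h1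
      refine h1.congr' (hM.mono fun N h => ?_)
      rw [Pi.div_apply, h, inv_div]
  have h2 := (h.inv_rev (by
    filter_upwards [(tendsto_logqN_atTop hp0 hp1).eventually_gt_atTop 0] with N hN h0
    exact absurd h0 hN.ne')).pow 2
  exact h2.congr_left fun N => by simp

theorem isBigO_expected_clumps :
    (fun N : ℕ => N * (clumpRate T p (M N) * Real.exp (-(T / (qZero T p * M N))))
      - p ^ (x N * exponentFactor T p N)) =O[atTop] fun N => (logqN p N)⁻¹ ^ 2 := by
  have hc := log_one_div_pos hp0 hp1
  set A := T * Real.logb (1 / p) ((1 - p) / p) - Real.logb (1 / p) (T.factorial : ℝ) with hA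
  have hE := isBigO_centering_equation (T := T) (q₀ := qZero T p) (A := A) hc
    (tendsto_logqN_atTop hp0 hp1) hx (M := fun N => (M N : ℝ)) (hM.mono fun N h => by
      rw [h, centering_eq, ← hA]; ring)
  have hE1 := hE.const_mul_left (-Real.log (1 / p))
  have hw0 : Tendsto (fun N => (logqN p N)⁻¹ ^ 2) atTop (nhds 0) := by
    have := (tendsto_inv_atTop_zero.comp (tendsto_logqN_atTop hp0 hp1)).pow 2
    simpa using this
  have h1 := (isBigO_exp_sub_one (hE1.trans_tendsto hw0)).trans hE1
  have h2 := isBigO_one_exp ((isBigO_one_mul_exponentFactor (T := T) hp0 hp1 hx).const_mul_left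
    (-Real.log (1 / p)))
  refine (isBigO_mul_of_isBigO_one h1 h2).congr' ?_ .rfl
  filter_upwards [eventually_gt_atTop 0,
    (tendsto_natCast_runLength_atTop hp0 hp1 hx hM).eventually_gt_atTop 0] with N hN hMN
  rw [mul_clumpRate_mul_exp hp0 hp1 hN (by exact_mod_cast hMN), ← hA, sub_mul, one_mul,
    ← Real.exp_add, Real.rpow_def_of_pos hp0]
  have h3 : Real.log p = -Real.log (1 / p) := by rw [one_div, Real.log_inv, neg_neg]
  rw [h3]
  congr 2
  simp only [exponentFactor, loglogqN_eq]
  ring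

theorem isBigO_one_mul_clumpRate :
    (fun N : ℕ => N * clumpRate T p (M N)) =O[atTop] fun _ => (1 : ℝ) := by
  have hM0 := tendsto_natCast_runLength_atTop hp0 hp1 hx hM
  have hw : (fun N => (logqN p N)⁻¹ ^ 2) =O[atTop] fun _ => (1 : ℝ) := by
    have := (tendsto_inv_atTop_zero.comp (tendsto_logqN_atTop hp0 hp1)).pow 2
    exact this.isBigO_one ℝ
  have h1 := ((isBigO_expected_clumps hp0 hp1 hx hM).trans hw).add
    (isBigO_one_rpow_exponentFactor (T := T) hp0 hp1 hx)
  have h2 : (fun N => (T / (qZero T p * M N) : ℝ)) =O[atTop] fun _ => (1 : ℝ) := by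
    have := (tendsto_inv_atTop_zero.comp hM0).const_mul (T / qZero T p : ℝ)
    refine (this.isBigO_one ℝ).congr_left fun N => ?_
    simp only [Function.comp, div_eq_mul_inv, mul_inv]
    ring
  refine (isBigO_one_mul h1 (isBigO_one_exp h2)).congr_left fun N => ?_
  rw [sub_add_cancel, mul_assoc, mul_assoc, ← Real.exp_add, neg_add_cancel, Real.exp_zero, mul_one]

theorem isBigO_mul_tossProb_runOnlyAtStart (hT : T = 1 ∨ T = 2) :
    (fun N : ℕ => N * tossProb p (2 * M N) (RunOnlyAtStart T (M N))
      - p ^ (x N * exponentFactor T p N)) =O[atTop] fun N => (logqN p N)⁻¹ ^ 2 := by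
  have hM0 : Tendsto M atTop atTop :=
    tendsto_natCast_atTop_iff.1 (tendsto_natCast_runLength_atTop hp0 hp1 hx hM)
  have h1 := (isBigO_refl (fun N : ℕ => (N : ℝ)) atTop).mul
    ((isBigO_tossProb_runOnlyAtStart hT hp0 hp1).comp_tendsto hM0)
  have h2 := (isBigO_one_mul_clumpRate hp0 hp1 hx hM).mul (isBigO_runLength_inv_sq hp0 hp1 hx hM)
  have h3 := (h1.trans (h2.congr_left (f₂ := fun N : ℕ => (N : ℝ) *
    ((fun m : ℕ => clumpRate T p m / (m : ℝ) ^ 2) ∘ M) N) fun N => by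
      simp only [Function.comp]; ring)).congr_right fun N => one_mul _
  refine (h3.add (isBigO_expected_clumps hp0 hp1 hx hM)).congr_left fun N => ?_
  simp only [Function.comp]
  ring

/-- Since N F is bounded, the whole expression is O(L/N), with L = log(qN), and L³/N is bounded. The
summand 1 next to 2M accounts for passing from the longest run to `RunFree`. -/
theorem isBigO_tossProb_runFree_error :
    (fun N : ℕ => (2 * M N + 1) * tossProb p (M N) (fun l => l.count false ≤ T)
      + N * (3 * M N * tossProb p (M N) (fun l => l.count false ≤ T) ^ 2))
      =O[atTop] fun N => (logqN p N)⁻¹ ^ 2 := by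
  have hMt := tendsto_natCast_runLength_atTop hp0 hp1 hx hM
  have hM0 : Tendsto M atTop atTop := tendsto_natCast_atTop_iff.1 hMt
  have hF := (isBigO_refl (fun N : ℕ => (N : ℝ)) atTop).mul
    ((isBigO_tossProb_count_le hp0 hp1 T).comp_tendsto hM0)
  have hF1 : (fun N : ℕ => N * tossProb p (M N) (fun l => l.count false ≤ T)) =O[atTop]
      fun _ => (1 : ℝ) := hF.trans (isBigO_one_mul_clumpRate hp0 hp1 hx hM)
  have hML := isBigO_runLength_logqN hp0 hp1 hx hM
  have h1L : (fun _ : ℕ => (1 : ℝ)) =O[atTop] logqN p :=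
    ((isLittleO_const_left_of_ne one_ne_zero).2 (
      tendsto_norm_atTop_atTop.comp (tendsto_logqN_atTop hp0 hp1))).isBigO
  have h3 : (fun N : ℕ => logqN p N / N) =O[atTop] fun N => (logqN p N)⁻¹ ^ 2 := by
    have := (isLittleO_logqN_pow hp1 3).tendsto_div_nhds_zero.isBigO_one ℝ
    refine (isBigO_mul_of_isBigO_one (isBigO_refl (fun N => (logqN p N)⁻¹ ^ 2) atTop)
      this).congr' ?_ .rfl
    filter_upwards [(tendsto_logqN_atTop hp0 hp1).eventually_gt_atTop 0] with N hN
    field_simp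
  have h4 : (fun N : ℕ => (2 * M N + 1) * (N * tossProb p (M N) (fun l => l.count false ≤ T))
      + 3 * M N * (N * tossProb p (M N) (fun l => l.count false ≤ T)) ^ 2) =O[atTop] logqN p :=
    (isBigO_mul_of_isBigO_one ((hML.const_mul_left 2).add h1L) hF1).add
      (isBigO_mul_of_isBigO_one (hML.const_mul_left 3) (by simpa using hF1.pow 2))
  refine ((h4.mul (isBigO_refl (fun N : ℕ => (N : ℝ)⁻¹) atTop)).trans h3).congr' ?_ .rfl
  filter_upwards [eventually_gt_atTop 0] with N hN
  have : (N : ℝ) ≠ 0 := by positivity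
  field_simp

theorem isBigO_tossProb_longestRun_lt (hT : T = 1 ∨ T = 2) :
    (fun N : ℕ => tossProb p N
        (fun l => ∃ y : Fin N → Bool, List.ofFn y = l ∧ longestRun T y < M N)
      - Real.exp (-(p ^ (x N * exponentFactor T p N)))) =O[atTop]
      fun N => (logqN p N)⁻¹ ^ 2 := by
  have hMt := tendsto_natCast_runLength_atTop hp0 hp1 hx hM
  have hMN : ∀ᶠ N in atTop, M N ≤ N := by
    have h := ((isBigO_runLength_logqN hp0 hp1 hx hM).trans_isLittleO
      (by simpa using isLittleO_logqN_pow hp1 1)).bound one_pos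
    refine h.mono fun N hN => ?_
    rw [one_mul, Real.norm_natCast, Real.norm_natCast] at hN
    exact_mod_cast hN
  have h1 := (isBigO_tossProb_runFree_error (T := T) hp0 hp1 hx hM).norm_left.add
    (isBigO_mul_tossProb_runOnlyAtStart hp0 hp1 hx hM hT).norm_left
  refine IsBigO.trans (IsBigO.of_bound 1 ?_) h1
  filter_upwards [hMN, hMt.eventually_gt_atTop 0] with N hN hM0
  have hM0' : 0 < M N := by exact_mod_cast hM0
  have e1 := abs_tossProb_longestRun_lt_sub_le hp0.le hp1.le (T := T) hM0' hN
  have e2 := abs_tossProb_runFree_sub_exp_le hp0.le hp1.le (T := T) hM0' N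
  have e3 := abs_exp_neg_sub_exp_neg_le
    (mul_nonneg (Nat.cast_nonneg N) (tossProb_nonneg hp0.le hp1.le (2 * M N)
      (RunOnlyAtStart T (M N)))) (Real.rpow_pos_of_pos hp0 (x N * exponentFactor T p N)).le
  have e4 := (abs_sub_le _ _ _).trans (add_le_add ((abs_sub_le _ _ _).trans (add_le_add e1 e2)) e3)
  rw [one_mul, Real.norm_eq_abs, Real.norm_of_nonneg (by positivity), Real.norm_eq_abs,
    Real.norm_eq_abs]
  refine e4.trans (le_trans ?_ (add_le_add_left (le_abs_self _) _))
  linarith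

end Main

/-- The error `R` depends only on `T`, `p`, `k` and `N`, not on the probability space. -/
theorem theorem2 (T : ℕ) (hT : T = 1 ∨ T = 2) (p : ℝ) (hp0 : 0 < p) (hp1 : p < 1) (k : ℤ) :
    ∃ R : ℕ → ℝ,
      R =O[atTop] (fun N : ℕ => 1 / (Real.logb (1 / p) (N : ℝ)) ^ 2) ∧
      ∀ᶠ N : ℕ in atTop,
        ∀ (Ω : Type*) [MeasurableSpace Ω] (P : Measure Ω) [IsProbabilityMeasure P]
          (X : Fin N → Ω → Bool), IsCoinTossing P p X →
          P.real {ω | (longestRun T (fun i => X i ω) : ℤ) - ⌊centering T p N⌋ < k} =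
            Real.exp (-(p ^ (((k : ℝ) - Int.fract (centering T p N)) * exponentFactor T p N)))
              * (1 + R N) := by
  -- With this bounded shift, `centering` plus x is the integer [m(N)] + k.
  set x : ℕ → ℝ := fun N => (k : ℝ) - Int.fract (centering T p N) with hxdef
  set M : ℕ → ℕ := fun N => (⌊centering T p N⌋ + k).toNat with hMdef
  have hx : x =O[atTop] fun _ => (1 : ℝ) := by
    refine (isBigO_one_const (k : ℝ)).sub (IsBigO.of_bound 1 (Eventually.of_forall fun N => ?_))
    rw [norm_one, one_mul, Real.norm_of_nonneg (Int.fract_nonneg _)]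
    exact (Int.fract_lt_one _).le
  have hx' : ∀ N, ((⌊centering T p N⌋ + k : ℤ) : ℝ) = centering T p N + x N := fun N => by
    push_cast
    simp only [hxdef, ← Int.self_sub_floor]
    ring
  have hpos : ∀ᶠ N in atTop, 0 < ⌊centering T p N⌋ + k := by
    filter_upwards [(tendsto_centering_add_atTop (T := T) hp0 hp1 hx).eventually_gt_atTop 0]
      with N hN
    rw [← hx'] at hN
    exact_mod_cast hN
  have hMZ : ∀ᶠ N in atTop, (M N : ℤ) = ⌊centering T p N⌋ + k :=
    hpos.mono fun N hN => Int.toNat_of_nonneg hN.le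
  have hM : ∀ᶠ N in atTop, (M N : ℝ) = centering T p N + x N := hMZ.mono fun N hN => by
    rw [← hx', ← hN, Int.cast_natCast]
  have h1 := isBigO_tossProb_longestRun_lt hp0 hp1 hx hM hT
  have h2 := isBigO_one_exp (isBigO_one_rpow_exponentFactor (T := T) hp0 hp1 hx)
  -- R is the absolute error divided by the limiting exponential; the inverse of that exponential is
  -- bounded, so R keeps the order of the absolute error.
  refine ⟨_, (isBigO_mul_of_isBigO_one h1 h2).trans (isBigO_logqN_inv_sq hp0 hp1), ?_⟩
  filter_upwards [hMZ] with N hN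
  intro Ω _ P _ X hX
  have h3 : {ω | (longestRun T (fun i => X i ω) : ℤ) - ⌊centering T p N⌋ < k} =
      {ω | longestRun T (fun i => X i ω) < M N} := by
    ext ω
    simp only [Set.mem_ofPred_eq]
    omega
  rw [h3, hX.measureReal_eq_tossProb fun y => longestRun T y < M N, Real.exp_neg]
  have := Real.exp_ne_zero (p ^ (x N * exponentFactor T p N))
  simp only [hxdef] at this ⊢
  field_simp
  ring
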